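/- Let $n \ge 2$. A convex body in $\mathbb{R}^n$ is a compact convex set with non-empty interior. For convex bodies $K, L \subset \mathbb{R}^n$ let $$d(K,L) = \inf\{ r > 0 : K+u \subset T(L+v) \subset r(K+u) \text{ for some invertible linear } T:\mathbb{R}^n\to\mathbb{R}^n \text{ and } u,v\in\mathbb{R}^n\}$$ be the Banach–Mazur distance, let $B_p^n = \{x\in\mathbb{R}^n : |x_1|^p+\dots+|x_n|^p\le 1\}$, and let $S_n$ be a regular simplex in $\mathbb{R}^n$. Let $K\subset\mathbb{R}^n$ be a convex body and $\varepsilon \ge 0$. (1) If $2 \le p < \infty$, $\varepsilon \le \left(2^{18}(p-1)n^{14}\right)^{-1}$ and $d(K,B_p^n) \ge (1-\varepsilon)n$, then $$d(K,S_n) \le 1 + 320\,(p-1)^{\frac13}\, n^{\frac{14}{3}}\, \varepsilon^{\frac13}.$$ (2) If $1 < p \le 2$, $\varepsilon \le \left(\frac{p}{p-1}\cdot 2^{\frac{15p-7}{p-1}}\cdot n^{\frac{11p-5}{p-1}}\right)^{-1}$ and $d(K,B_p^n) \ge (1-\varepsilon)n$, then $$d(K,S_n) \le 1 + 160\, n^{\frac92+\frac{1}{2(2p-1)}}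 \left(\frac{p}{p-1}\right)^{\frac12-\frac{1}{2(2p-1)}} \varepsilon^{\frac12-\frac{1}{2(2p-1)}}.$$ -/

import Mathlib

open scoped Pointwise

/-- A convex body: a compact convex set with non-empty interior. -/
structure IsConvexBody {E : Type*} [NormedAddCommGroup E] [NormedSpace ℝ E] (K : Set E) :
    Prop where
  isCompact : IsCompact K
  convex : Convex ℝ K
  interior_nonempty : (interior K).Nonempty

/-- The Banach-Mazur distance of two (not necessarily symmetric) convex bodies: the infimum of all
`r > 0` such that `K + u ⊆ T (L + v) ⊆ r (K + u)` for some invertible linear operator `T` and some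
vectors `u`, `v`. -/
noncomputable def banachMazurDist {E : Type*} [AddCommGroup E] [Module ℝ E] (K L : Set E) : ℝ :=
  sInf {r : ℝ | 0 < r ∧ ∃ (T : E ≃ₗ[ℝ] E) (u v : E),
    K + {u} ⊆ T '' (L + {v}) ∧ T '' (L + {v}) ⊆ r • (K + {u})}

/-- The unit ball of the `ℓ_p` norm in `ℝⁿ`. -/
def lpUnitBall (p : ℝ) (n : ℕ) : Set (EuclideanSpace ℝ (Fin n)) :=
  {x | ∑ i, |x i| ^ p ≤ 1}

/-! Put `K` in a position of maximal volume inside `L`, the `ℓ_p` ball. John's theorem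
(`exists_john_decomposition`) gives weights `c i`, points `x i` of `K` and `y i` of the polar of `L`
with `∑ c i x i ⊗ y i = id`, `∑ c i y i = 0` and `∑ c i = n`. On the other hand, a distance of at
least `r = (1 - ε) n` means that no translate of `L` fits into a multiple of `K` by a factor below
`r`. By separation and Carathéodory this yields at most `n + 1` nonzero functionals `g j` with sum
zero that witness the failure (`exists_obstruction_of_le_banachMazurDist`). After scaling, the
functions `b j = h j - ⟪g j, ·⟫`, with `h j` the support number of `K`, are nonnegative on `K` and
sum to one: they are barycentric coordinates for a candidate simplex around `K`.

Let `ξ j` maximize `g j` on `L`. Combining both structures gives `∑ c i b j (x i) (1 + ⟪y i, ξ j⟫) ≤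
ε n` (`sum_defect_le`). Since `L` is symmetric, all terms are nonnegative, and a term with positive
weight vanishes only if `y i` norms `-ξ j`. A power-type convexity modulus of the polar therefore
forces `y i` to be close, in weighted quadratic mean, to a single vector `Y j`. So the John identity
is approximately carried by the few vectors `Y j`. Nondegeneracy then forces exactly `n + 1` of
them, separated from each other and each of substantial mass, and the coordinates `b j (x i)` must
be nearly 0 or 1 (`sum_mass_mul_one_sub_le`). Averaging the `x i` gives points of `K` near every
vertex, so `K` is close to a simplex (`banachMazurDist_simplex_le`).

For the `ℓ_p` ball the modulus is the coordinatewise defect in Young's inequality: of power type 2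
when `p ≥ 2`, and of power type `q = p / (p - 1)` when `p ≤ 2`. The resulting bounds have a higher
order in `ε` than the stated ones; the smallness of `ε` absorbs the surplus powers of `n`. -/

/-! ### Convex hulls of compact sets -/

section Compactness

variable {V : Type*} [NormedAddCommGroup V] [NormedSpace ℝ V] [FiniteDimensional ℝ V]

/-- In a finite-dimensional space the convex hull of a compact set is compact. -/
theorem IsCompact.convexHull_of_finiteDimensional {s : Set V} (hs : IsCompact s) :
    IsCompact (convexHull ℝ s) := by
  classical
  rcases s.eq_empty_or_nonempty with rfl | ⟨a, ha⟩
  · simp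
  set d := Module.finrank ℝ V + 1
  let g : (Fin d → ℝ) × (Fin d → V) → V := fun q => ∑ i, q.1 i • q.2 i
  have hg : Continuous g := by fun_prop
  have hc : IsCompact (g '' (stdSimplex ℝ (Fin d) ×ˢ Set.univ.pi fun _ => s)) :=
    ((isCompact_stdSimplex ℝ (Fin d)).prod (isCompact_univ_pi fun _ => hs)).image hg
  convert hc using 1
  apply Set.Subset.antisymm
  · intro x hx
    obtain ⟨ι, _, z, w, hz, hind, hw, hw1, rfl⟩ := eq_pos_convex_span_of_mem_convexHull hx
    have hcard : Fintype.card ι ≤ d := by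
      have := hind.card_le_finrank_succ
      exact this.trans (Nat.succ_le_succ (Submodule.finrank_le _))
    obtain ⟨e⟩ : Nonempty (ι ↪ Fin d) :=
      Function.Embedding.nonempty_of_card_le (by simpa using hcard)
    -- Unused slots get weight 0 and the dummy point `a ∈ s`, so that the padded tuple stays in the
    -- compact product.
    refine ⟨(Function.extend e w 0, Function.extend e z fun _ => a), ⟨⟨?_, ?_⟩, ?_⟩, ?_⟩
    · intro k
      by_cases hk : k ∈ Set.range e
      · obtain ⟨i, rfl⟩ := hk
        simpa [e.injective.extend_apply] using (hw i).le
      · simp [Function.extend_apply' _ _ _ hk]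
    · rw [← hw1]
      refine (Fintype.sum_of_injective e e.injective _ _ (fun k hk => ?_) fun i => ?_).symm
      · simp [Function.extend_apply' _ _ _ hk]
      · simp [e.injective.extend_apply]
    · intro k _
      by_cases hk : k ∈ Set.range e
      · obtain ⟨i, rfl⟩ := hk
        simpa [e.injective.extend_apply] using hz ⟨i, rfl⟩
      · simpa [Function.extend_apply' _ _ _ hk] using ha
    · refine (Fintype.sum_of_injective e e.injective _ _ (fun k hk => ?_) fun i => ?_).symm
      · simp [Function.extend_apply' _ _ _ hk]
      · simp [e.injective.extend_apply]
  · rintro _ ⟨⟨w, z⟩, ⟨⟨hw0, hw1⟩, hz⟩, rfl⟩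
    exact (convex_convexHull ℝ s).sum_mem (fun i _ => hw0 i) hw1
      fun i _ => subset_convexHull ℝ s (hz i trivial)

end Compactness

/-! ### Support functions and polars -/

section Support

variable {E : Type*} [NormedAddCommGroup E] [InnerProductSpace ℝ E]

/-- The support function of a set. -/
noncomputable def supportFun (A : Set E) (f : E) : ℝ := sSup ((fun x => inner ℝ f x) '' A)

/-- The polar of a set. -/
def innerPolar (A : Set E) : Set E := {y | ∀ x ∈ A, inner ℝ y x ≤ 1}

theorem continuous_supportFun {A : Set E} (hA : IsCompact A) : Continuous (supportFun A) :=
  hA.continuous_sSup (f := fun f x => inner ℝ f x) (by fun_prop)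

theorem inner_le_supportFun {A : Set E} (hA : IsCompact A) (f : E) {x : E} (hx : x ∈ A) :
    inner ℝ f x ≤ supportFun A f :=
  le_csSup (hA.image (by fun_prop : Continuous fun x => inner ℝ f x)).bddAbove ⟨x, hx, rfl⟩

theorem exists_inner_eq_supportFun {A : Set E} (hA : IsCompact A) (hne : A.Nonempty) (f : E) :
    ∃ x ∈ A, inner ℝ f x = supportFun A f := by
  obtain ⟨x, hx, h⟩ := (hA.image (by fun_prop : Continuous fun x => inner ℝ f x)).sSup_mem
    (hne.image _)
  exact ⟨x, hx, h⟩

theorem supportFun_smul {A : Set E} (hA : IsCompact A) (hne : A.Nonempty) {t : ℝ} (ht : 0 ≤ t)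
    (f : E) : supportFun A (t • f) = t * supportFun A f := by
  obtain ⟨x, hx, h⟩ := exists_inner_eq_supportFun hA hne f
  obtain ⟨x', hx', h'⟩ := exists_inner_eq_supportFun hA hne (t • f)
  apply le_antisymm
  · rw [← h', inner_smul_left]
    exact mul_le_mul_of_nonneg_left (inner_le_supportFun hA f hx') ht
  · have := inner_le_supportFun hA (t • f) hx
    rw [inner_smul_left] at this
    rw [← h]; exact this

/-- The support function is strictly larger than the values at interior points. -/
theorem inner_lt_supportFun {A : Set E} (hA : IsCompact A) {f x : E} (hf : f ≠ 0)
    (hx : x ∈ interior A) : inner ℝ f x < supportFun A f := by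
  have hcont : Filter.Tendsto (fun t : ℝ => x + t • f) (nhdsWithin 0 (Set.Ioi 0)) (nhds x) := by
    have : Continuous fun t : ℝ => x + t • f := by fun_prop
    simpa using (this.tendsto 0).mono_left nhdsWithin_le_nhds
  obtain ⟨t, ht, ht0⟩ :=
    ((hcont.eventually (mem_interior_iff_mem_nhds.1 hx)).and self_mem_nhdsWithin).exists
  have h := inner_le_supportFun hA f ht
  rw [inner_add_right, inner_smul_right] at h
  have : 0 < t * inner ℝ f f := mul_pos ht0 (real_inner_self_pos.2 hf)
  linarith

theorem supportFun_pos {A : Set E} (hA : IsCompact A) (h0 : (0 : E) ∈ interior A) {f : E}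
    (hf : f ≠ 0) : 0 < supportFun A f := by
  simpa using inner_lt_supportFun hA hf h0

variable [FiniteDimensional ℝ E]

/-- A point below the support function of a compact convex set lies in the set. -/
theorem mem_of_inner_le_supportFun {A : Set E} (hA : IsCompact A) (hc : Convex ℝ A)
    (hne : A.Nonempty) {x : E} (h : ∀ f, inner ℝ f x ≤ supportFun A f) : x ∈ A := by
  by_contra hx
  obtain ⟨F, u, h1, h2⟩ := geometric_hahn_banach_closed_point hc hA.isClosed hx
  obtain ⟨a, ha, hae⟩ := exists_inner_eq_supportFun hA hne ((InnerProductSpace.toDual ℝ E).symm F)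
  have h3 := h ((InnerProductSpace.toDual ℝ E).symm F)
  rw [← hae] at h3
  simp only [InnerProductSpace.toDual_symm_apply] at h3
  linarith [h1 a ha]

theorem isCompact_innerPolar {A : Set E} (h0 : (0 : E) ∈ interior A) :
    IsCompact (innerPolar A) := by
  apply Metric.isCompact_of_isClosed_isBounded
  · have : innerPolar A = ⋂ x ∈ A, {y | inner ℝ y x ≤ 1} := by
      ext; simp [innerPolar]
    rw [this]
    exact isClosed_biInter fun x _ => isClosed_le (by fun_prop) continuous_const
  · obtain ⟨r, hr, hb⟩ := Metric.mem_nhds_iff.1 (mem_interior_iff_mem_nhds.1 h0)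
    refine (Metric.isBounded_iff_subset_closedBall 0).2 ⟨2 / r, fun y hy => ?_⟩
    rw [mem_closedBall_zero_iff]
    rcases eq_or_ne y 0 with rfl | hy0
    · simp; positivity
    have hn : 0 < ‖y‖ := norm_pos_iff.2 hy0
    have hm : (r / (2 * ‖y‖)) • y ∈ A := by
      apply hb
      rw [mem_ball_zero_iff, norm_smul, Real.norm_of_nonneg (by positivity)]
      field_simp; linarith
    have := hy _ hm
    rw [inner_smul_right, real_inner_self_eq_norm_sq] at this
    rw [le_div_iff₀ hr]
    have h2 : r / (2 * ‖y‖) * ‖y‖ ^ 2 = r * ‖y‖ / 2 := by field_simp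
    nlinarith

/-- A compact convex set with the origin in its interior is the polar of its polar. -/
theorem mem_of_forall_innerPolar {A : Set E} (hA : IsCompact A) (hc : Convex ℝ A)
    (h0 : (0 : E) ∈ interior A) {x : E} (h : ∀ y ∈ innerPolar A, inner ℝ y x ≤ 1) : x ∈ A := by
  refine mem_of_inner_le_supportFun hA hc ⟨0, interior_subset h0⟩ fun f => ?_
  rcases eq_or_ne f 0 with rfl | hf
  · simpa using inner_le_supportFun hA 0 (interior_subset h0)
  have hp := supportFun_pos hA h0 hf
  have := h ((supportFun A f)⁻¹ • f) fun z hz => by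
    rw [real_inner_smul_left, inv_mul_le_iff₀ hp, mul_one]
    exact inner_le_supportFun hA f hz
  rwa [real_inner_smul_left, inv_mul_le_iff₀ hp, mul_one] at this

end Support

/-! ### John's decomposition by a separation argument -/

section John

variable {E : Type*} [NormedAddCommGroup E] [InnerProductSpace ℝ E]

/-- If an affine direction points strictly inwards at all contact pairs, a small step along it
keeps `K` inside `L`. -/
theorem eventually_inner_add_smul_le {Q : Set (E × E)} (hQ : IsCompact Q)
    (hQ1 : ∀ q ∈ Q, inner ℝ q.2 q.1 ≤ 1) {g : E × E → ℝ} (hg : Continuous g)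
    (hneg : ∀ q ∈ Q, inner ℝ q.2 q.1 = 1 → g q < 0) :
    ∀ᶠ t in nhdsWithin (0 : ℝ) (Set.Ioi 0), ∀ q ∈ Q, inner ℝ q.2 q.1 + t * g q ≤ 1 := by
  have hin : Continuous fun q : E × E => inner ℝ q.2 q.1 := by fun_prop
  -- Only pairs with `g ≥ 0` can be harmed by the perturbation; on this compact set the pairing
  -- stays below 1 by a fixed margin `δ`.
  set Z := Q ∩ {q | 0 ≤ g q}
  have hZ : IsCompact Z := hQ.inter_right (isClosed_le continuous_const hg)
  obtain ⟨δ, hδ, hδZ⟩ : ∃ δ > 0, ∀ q ∈ Z, inner ℝ q.2 q.1 ≤ 1 - δ := by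
    rcases Z.eq_empty_or_nonempty with h | h
    · exact ⟨1, one_pos, by simp [h]⟩
    · obtain ⟨q, hq, hmax⟩ := hZ.exists_isMaxOn h hin.continuousOn
      refine ⟨1 - inner ℝ q.2 q.1, ?_, fun q' hq' => ?_⟩
      · have h1 := hQ1 q hq.1
        rcases h1.lt_or_eq with h1 | h1
        · linarith
        · exact absurd (hneg q hq.1 h1) (not_lt.2 hq.2)
      · have := hmax hq'
        simp only [Set.mem_ofPred_eq] at this
        linarith
  obtain ⟨M, hM⟩ := hQ.exists_bound_of_continuousOn hg.continuousOn
  have hpos : 0 < δ / (|M| + 1) := by positivity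
  filter_upwards [Ioo_mem_nhdsGT hpos] with t ht q hq
  rcases lt_or_ge (g q) 0 with h | h
  · nlinarith [hQ1 q hq, ht.1]
  · have h1 := hδZ q ⟨hq, h⟩
    have h2 : g q ≤ |M| + 1 := by
      have := hM q hq
      rw [Real.norm_eq_abs] at this
      linarith [le_abs_self (g q), le_abs_self M]
    have h3 : t * g q ≤ δ := by
      calc t * g q ≤ δ / (|M| + 1) * (|M| + 1) :=
            mul_le_mul ht.2.le h2 h (by positivity)
        _ = δ := by field_simp
    linarith

variable [FiniteDimensional ℝ E]

/-- The expansion `det (1 + t B) = 1 + t tr B + O(t²)`: a perturbation of positive trace increases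
volume to first order. -/
theorem eventually_one_lt_det {B : E →L[ℝ] E} (hB : 0 < LinearMap.trace ℝ E B) :
    ∀ᶠ t in nhdsWithin (0 : ℝ) (Set.Ioi 0),
      1 < (ContinuousLinearMap.id ℝ E + t • B).det := by
  classical
  set b := (stdOrthonormalBasis ℝ E).toBasis
  set M := LinearMap.toMatrix b b (B : E →ₗ[ℝ] E) with hM
  set P := (1 + (Polynomial.X : Polynomial ℝ) • M.map Polynomial.C).det.divX.divX
  have htr : 0 < M.trace := by rwa [hM, ← LinearMap.trace_eq_matrix_trace]
  have hdet : ∀ t : ℝ, (ContinuousLinearMap.id ℝ E + t • B).det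
      = 1 + t * (M.trace + P.eval t * t) := by
    intro t
    have : LinearMap.toMatrix b b ((ContinuousLinearMap.id ℝ E + t • B : E →L[ℝ] E) : E →ₗ[ℝ] E)
        = 1 + t • M := by
      simp [hM]
    rw [ContinuousLinearMap.det, ← LinearMap.det_toMatrix b, this, Matrix.det_one_add_smul]
    ring
  have hc : Continuous fun t : ℝ => M.trace + P.eval t * t := by fun_prop
  have h1 : ∀ᶠ t in nhdsWithin (0 : ℝ) (Set.Ioi 0), 0 < M.trace + P.eval t * t :=
    ((hc.tendsto 0).mono_left nhdsWithin_le_nhds).eventually_const_lt (by simpa using htr)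
  filter_upwards [h1, self_mem_nhdsWithin] with t ht ht0
  rw [hdet]
  have : 0 < t * (M.trace + P.eval t * t) := mul_pos ht0 ht
  linarith

/-- **John's theorem** for the position of maximal volume of a compact set in a convex body. -/
theorem exists_john_decomposition [Nontrivial E] {K L : Set E} (hL : IsCompact L)
    (hLc : Convex ℝ L) (hL0 : (0 : E) ∈ interior L) (hK : IsCompact K)
    (hKL : K ⊆ L)
    (hmax : ∀ (T : E →L[ℝ] E) (v : E), (∀ x ∈ K, T x + v ∈ L) → T.det ≤ 1) :
    ∃ (ι : Type) (_ : Fintype ι) (c : ι → ℝ) (x y : ι → E), (∀ i, 0 ≤ c i) ∧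
      (∀ i, x i ∈ K) ∧ (∀ i, y i ∈ innerPolar L) ∧
      (∀ z, ∑ i, (c i * inner ℝ (y i) z) • x i = z) ∧ ∑ i, c i • y i = 0 ∧
      ∑ i, c i = (Module.finrank ℝ E : ℝ) := by
  set N : ℝ := (Module.finrank ℝ E : ℝ) with hN
  have hNpos : 0 < N := by
    rw [hN]; exact_mod_cast Module.finrank_pos
  set Q : Set (E × E) := K ×ˢ innerPolar L
  have hQ : IsCompact Q := hK.prod (isCompact_innerPolar hL0)
  have hQ1 : ∀ q ∈ Q, inner ℝ q.2 q.1 ≤ 1 := fun q hq => hq.2 _ (hKL hq.1)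
  set C : Set (E × E) := Q ∩ {q | inner ℝ q.2 q.1 = 1}
  have hC : IsCompact C := hQ.inter_right (isClosed_eq (by fun_prop) continuous_const)
  -- One vector encodes both John identities, so the theorem becomes membership of `(id / N, 0)` in
  -- the convex hull of the images of the contact pairs.
  set φ : E × E → (E →L[ℝ] E) × E := fun q => (InnerProductSpace.rankOne ℝ q.1 q.2, q.2)
  have hφ : Continuous φ := by
    refine Continuous.prodMk ?_ continuous_snd
    exact ((InnerProductSpace.rankOne ℝ).continuous.comp continuous_fst).clm_apply continuous_snd
  have hD : IsCompact (convexHull ℝ (φ '' C)) :=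
    (hC.image hφ).convexHull_of_finiteDimensional
  by_cases hmem : ((N⁻¹ • ContinuousLinearMap.id ℝ E, 0) : (E →L[ℝ] E) × E)
      ∈ convexHull ℝ (φ '' C)
  · obtain ⟨ι, _, w, z, hw, hw1, hz, hsum⟩ := mem_convexHull_iff_exists_fintype.1 hmem
    choose q hq hqz using hz
    have h1 : ∑ i, w i • InnerProductSpace.rankOne ℝ (q i).1 (q i).2
        = N⁻¹ • ContinuousLinearMap.id ℝ E := by
      have := congrArg Prod.fst hsum
      simpa [Prod.fst_sum, ← hqz, φ] using this
    have h2 : ∑ i, w i • (q i).2 = 0 := by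
      have := congrArg Prod.snd hsum
      simpa [Prod.snd_sum, ← hqz, φ] using this
    refine ⟨ι, inferInstance, fun i => N * w i, fun i => (q i).1, fun i => (q i).2,
      fun i => mul_nonneg hNpos.le (hw i), fun i => (hq i).1.1, fun i => (hq i).1.2, ?_, ?_, ?_⟩
    · intro z
      have := congrArg (fun T : E →L[ℝ] E => N • T z) h1
      simp only [_root_.sum_apply, _root_.smul_apply,
        InnerProductSpace.rankOne_apply, ContinuousLinearMap.id_apply, smul_smul,
        Finset.smul_sum, mul_inv_cancel₀ hNpos.ne', one_smul] at this
      simpa [mul_assoc] using this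
    · simp only [mul_smul]
      rw [← Finset.smul_sum, h2, smul_zero]
    · rw [← Finset.mul_sum, hw1, mul_one]
  · exfalso
    obtain ⟨F, u, hF, hu⟩ :=
      geometric_hahn_banach_closed_point (convex_convexHull ℝ _) hD.isClosed hmem
    set G : (E →L[ℝ] E) →L[ℝ] ℝ := F.comp (ContinuousLinearMap.inl ℝ _ _) with hG
    set w : E := (InnerProductSpace.toDual ℝ E).symm (F.comp (ContinuousLinearMap.inr ℝ _ _))
      with hw
    have hFsplit : ∀ T v, F (T, v) = G T + inner ℝ v w := by
      intro T v
      rw [real_inner_comm, hw, InnerProductSpace.toDual_symm_apply, hG]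
      simp [← map_add]
    set b := stdOrthonormalBasis ℝ E
    -- The operator representing the functional `G`: `⟪y, B₀ x⟫ = G (x ⊗ y)`, and hence `tr B₀ = G
    -- id`.
    set B₀ : E →L[ℝ] E := ∑ k,
      (G.comp ((InnerProductSpace.rankOne ℝ (E := E) (F := E)).flip (b k))).smulRight (b k)
      with hB₀
    have hB₀inner : ∀ x y, inner ℝ y (B₀ x) = G (InnerProductSpace.rankOne ℝ x y) := by
      intro x y
      have : InnerProductSpace.rankOne ℝ x y
          = ∑ k, inner ℝ y (b k) • InnerProductSpace.rankOne ℝ x (b k) := by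
        conv_lhs => rw [← b.sum_repr y]
        simp [b.repr_apply_apply, real_inner_comm]
      rw [this, hB₀]
      simp [inner_sum, inner_smul_right, mul_comm]
    have htr₀ : LinearMap.trace ℝ E B₀ = G (ContinuousLinearMap.id ℝ E) := by
      rw [LinearMap.trace_eq_sum_inner _ b]
      have : ContinuousLinearMap.id ℝ E
          = ∑ k, InnerProductSpace.rankOne ℝ (b k) (b k) := by
        ext z
        simp [InnerProductSpace.rankOne_apply, b.sum_repr']
      rw [this, map_sum]
      exact Finset.sum_congr rfl fun k _ => hB₀inner _ _
    -- Contact pairs satisfy `⟪y, x⟫ = 1`, so subtracting `u • id` moves the separation threshold to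
    -- 0: the field `B x + w` points inwards at every contact pair while `tr B > 0`, which
    -- contradicts maximality.
    set B : E →L[ℝ] E := B₀ - u • ContinuousLinearMap.id ℝ E with hB
    have htr : 0 < LinearMap.trace ℝ E B := by
      have : LinearMap.trace ℝ E B = G (ContinuousLinearMap.id ℝ E) - u * N := by
        rw [hB, ← htr₀]
        simp [hN]
      rw [this]
      rw [hFsplit] at hu
      simp only [map_smul, inner_zero_left, add_zero, smul_eq_mul] at hu
      rw [lt_inv_mul_iff₀ hNpos] at hu
      linarith
    set g : E × E → ℝ := fun q => inner ℝ q.2 (B q.1 + w) with hg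
    have hgc : Continuous g := by fun_prop
    have hneg : ∀ q ∈ Q, inner ℝ q.2 q.1 = 1 → g q < 0 := by
      intro q hq hq1
      have := hF (φ q) (subset_convexHull ℝ _ ⟨q, ⟨hq, hq1⟩, rfl⟩)
      rw [hFsplit, ← hB₀inner] at this
      simp only [hg, hB, inner_add_right, _root_.sub_apply, inner_sub_right,
        _root_.smul_apply, ContinuousLinearMap.id_apply, inner_smul_right, hq1]
      linarith
    obtain ⟨t, ht1, ht2⟩ := ((eventually_one_lt_det htr).and
      (eventually_inner_add_smul_le hQ hQ1 hgc hneg)).exists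
    refine absurd (hmax (ContinuousLinearMap.id ℝ E + t • B) (t • w) fun x hx => ?_) (not_le.2 ht1)
    refine mem_of_forall_innerPolar hL hLc hL0 fun y hy => ?_
    have := ht2 (x, y) ⟨hx, hy⟩
    simp only [hg, inner_add_right] at this
    simp only [_root_.add_apply, ContinuousLinearMap.id_apply,
      _root_.smul_apply, inner_add_right, inner_smul_right]
    linarith

end John

/-! ### Existence of a position of maximal volume -/

section Position

variable {E : Type*} [NormedAddCommGroup E] [InnerProductSpace ℝ E] [FiniteDimensional ℝ E]

/-- The affine maps sending a body `K` with interior into a compact set form a compact set. -/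
theorem isCompact_setOf_affine_mapsTo {K L : Set E} (hL : IsCompact L)
    (hKi : (interior K).Nonempty) :
    IsCompact {q : (E →L[ℝ] E) × E | ∀ x ∈ K, q.1 x + q.2 ∈ L} := by
  apply Metric.isCompact_of_isClosed_isBounded
  · have : {q : (E →L[ℝ] E) × E | ∀ x ∈ K, q.1 x + q.2 ∈ L}
        = ⋂ x ∈ K, (fun q : (E →L[ℝ] E) × E => q.1 x + q.2) ⁻¹' L := by
      ext; simp
    rw [this]
    exact isClosed_biInter fun x _ => hL.isClosed.preimage (by fun_prop)
  · obtain ⟨k, hk⟩ := hKi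
    obtain ⟨r, hr, hb⟩ := Metric.mem_nhds_iff.1 (mem_interior_iff_mem_nhds.1 hk)
    obtain ⟨R, hR⟩ := hL.isBounded.subset_closedBall 0
    have hR' : ∀ z ∈ L, ‖z‖ ≤ |R| := fun z hz =>
      (mem_closedBall_zero_iff.1 (hR hz)).trans (le_abs_self R)
    have hkK : k ∈ K := hb (Metric.mem_ball_self hr)
    refine (Metric.isBounded_iff_subset_closedBall 0).2
      ⟨4 * |R| / r + (|R| + 4 * |R| / r * ‖k‖), fun q hq => ?_⟩
    have hT : ‖q.1‖ ≤ 4 * |R| / r := by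
      refine ContinuousLinearMap.opNorm_le_bound _ (by positivity) fun z => ?_
      rcases eq_or_ne z 0 with rfl | hz
      · simp
      have hzn : 0 < ‖z‖ := norm_pos_iff.2 hz
      set z' := (r / (2 * ‖z‖)) • z
      have hz' : k + z' ∈ K := by
        apply hb
        rw [mem_ball_iff_norm, add_sub_cancel_left, norm_smul, Real.norm_of_nonneg (by positivity)]
        field_simp; linarith
      have h1 : q.1 z' = (q.1 (k + z') + q.2) - (q.1 k + q.2) := by simp
      have h2 : ‖q.1 z'‖ ≤ |R| + |R| := by
        rw [h1]
        exact (norm_sub_le _ _).trans (add_le_add (hR' _ (hq _ hz')) (hR' _ (hq _ hkK)))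
      rw [map_smul, norm_smul, Real.norm_of_nonneg (by positivity)] at h2
      rw [div_mul_eq_mul_div, div_le_iff₀ (by positivity)] at h2
      rw [div_mul_eq_mul_div, le_div_iff₀ hr]
      linarith
    have hv : ‖q.2‖ ≤ |R| + 4 * |R| / r * ‖k‖ := by
      have h1 : q.2 = (q.1 k + q.2) - q.1 k := by simp
      rw [h1]
      refine (norm_sub_le _ _).trans (add_le_add (hR' _ (hq _ hkK)) ?_)
      exact (q.1.le_opNorm k).trans (mul_le_mul_of_nonneg_right hT (norm_nonneg _))
    rw [mem_closedBall_zero_iff, Prod.norm_def]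
    have h1 : 0 ≤ 4 * |R| / r := by positivity
    have h2 : 0 ≤ |R| + 4 * |R| / r * ‖k‖ := by positivity
    exact max_le (by linarith) (by linarith)

/-- There is an affine image of `K` of maximal volume inside `L`. -/
theorem exists_position_det_le_one {K L : Set E} (hL : IsCompact L)
    (hL0 : (0 : E) ∈ interior L) (hK : IsCompact K) (hKi : (interior K).Nonempty) :
    ∃ (T : E ≃ₗ[ℝ] E) (v : E), (∀ x ∈ K, T x + v ∈ L) ∧
      ∀ (T' : E →L[ℝ] E) (v' : E), (∀ x ∈ K, T' (T x + v) + v' ∈ L) → T'.det ≤ 1 := by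
  set A := {q : (E →L[ℝ] E) × E | ∀ x ∈ K, q.1 x + q.2 ∈ L}
  have hA : IsCompact A := isCompact_setOf_affine_mapsTo hL hKi
  obtain ⟨t, ht, htA⟩ : ∃ t : ℝ, 0 < t ∧ (t • ContinuousLinearMap.id ℝ E, (0 : E)) ∈ A := by
    obtain ⟨r, hr, hb⟩ := Metric.mem_nhds_iff.1 (mem_interior_iff_mem_nhds.1 hL0)
    obtain ⟨R, hR⟩ := hK.isBounded.subset_closedBall 0
    refine ⟨r / (|R| + 1), by positivity, fun x hx => hb ?_⟩
    have hx' : ‖x‖ ≤ |R| := (mem_closedBall_zero_iff.1 (hR hx)).trans (le_abs_self R)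
    simp only [_root_.smul_apply, ContinuousLinearMap.id_apply, add_zero,
      mem_ball_zero_iff, norm_smul]
    rw [Real.norm_of_nonneg (by positivity), div_mul_eq_mul_div, div_lt_iff₀ (by positivity)]
    nlinarith
  -- Maximizing the absolute value ignores orientation; the small homothety found above makes the
  -- maximum positive and the maximizer invertible.
  have hcont : Continuous fun q : (E →L[ℝ] E) × E => |q.1.det| :=
    (ContinuousLinearMap.continuous_det.comp continuous_fst).abs
  obtain ⟨q, hq, hmax⟩ := hA.exists_isMaxOn ⟨_, htA⟩ hcont.continuousOn
  have hpos : 0 < |q.1.det| := by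
    refine lt_of_lt_of_le ?_ (hmax htA)
    rw [abs_pos]
    simp [ContinuousLinearMap.det, ht.ne']
  have hdet : IsUnit (LinearMap.det (q.1 : E →ₗ[ℝ] E)) := isUnit_iff_ne_zero.2 (abs_pos.1 hpos)
  refine ⟨LinearEquiv.ofIsUnitDet (v := Module.finBasis ℝ E) (v' := Module.finBasis ℝ E)
    (f := (q.1 : E →ₗ[ℝ] E)) (by rwa [LinearMap.det_toMatrix]), q.2, hq, fun T' v' h => ?_⟩
  have hmem : (T'.comp q.1, T' q.2 + v') ∈ A := by
    intro x hx
    have := h x hx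
    simp only [map_add] at this
    simpa [add_assoc] using this
  have h1 : |(T'.comp q.1).det| ≤ |q.1.det| := hmax hmem
  have h2 : (T'.comp q.1).det = T'.det * q.1.det := by
    simp [ContinuousLinearMap.det]
  rw [h2, abs_mul] at h1
  have h3 : |T'.det| ≤ 1 := by
    by_contra h4
    nlinarith [not_le.1 h4]
  exact (le_abs_self _).trans h3

end Position

/-! ### Functionals obstructing a translate -/

section Obstruction

/-- Carathéodory-type reduction of a convex representation of the origin on which a given function
has nonnegative average. -/
theorem exists_reduced_convex_relation {V : Type*} [AddCommGroup V] [Module ℝ V]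
    [FiniteDimensional ℝ V] (s : V → ℝ) (k : ℕ) :
    ∀ (t : Finset V) (l : V → ℝ), t.card = k → (∀ e ∈ t, 0 < l e) → ∑ e ∈ t, l e = 1 →
      ∑ e ∈ t, l e • e = 0 → 0 ≤ ∑ e ∈ t, l e * s e →
    ∃ (t' : Finset V) (l' : V → ℝ), t' ⊆ t ∧ t'.card ≤ Module.finrank ℝ V + 1 ∧
      (∀ e ∈ t', 0 < l' e) ∧ ∑ e ∈ t', l' e = 1 ∧
      ∑ e ∈ t', l' e • e = 0 ∧ 0 ≤ ∑ e ∈ t', l' e * s e := by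
  classical
  induction k using Nat.strong_induction_on with
  | _ k ih =>
  intro t l hk hpos h1 h0 hs
  rcases le_or_gt t.card (Module.finrank ℝ V + 1) with hc | hc
  · exact ⟨t, l, subset_rfl, hc, hpos, h1, h0, hs⟩
  -- The sign of the affine dependence is chosen so that moving along `μ` does not decrease the
  -- average of `s`; `θ` below is the longest step keeping all weights nonnegative, and it kills the
  -- weight at `e₀`.
  obtain ⟨μ, hμ0, hμ1, hμs, hμne⟩ : ∃ μ : V → ℝ, ∑ e ∈ t, μ e • e = 0 ∧ ∑ e ∈ t, μ e = 0 ∧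
      0 ≤ ∑ e ∈ t, μ e * s e ∧ ∃ e ∈ t, μ e ≠ 0 := by
    obtain ⟨μ, a, b, e, he, c⟩ := Module.exists_nontrivial_relation_sum_zero_of_finrank_succ_lt_card hc
    rcases le_total 0 (∑ e ∈ t, μ e * s e) with h | h
    · exact ⟨μ, a, b, h, e, he, c⟩
    · exact ⟨fun e => -μ e, by simp [a], by simp [b], by simpa using h, e, he, by simpa using c⟩
  obtain ⟨e₁, he₁, hneg₁⟩ : ∃ e ∈ t, μ e < 0 := by
    obtain ⟨e, he, hlt⟩ := Finset.exists_pos_of_sum_zero_of_exists_nonzero (s := t)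
      (fun e => -μ e) (by simpa using hμ1) (by simpa using hμne)
    exact ⟨e, he, by simpa using hlt⟩
  obtain ⟨e₀, he₀, hmin⟩ := Finset.exists_min_image (t.filter fun e => μ e < 0)
    (fun e => l e / (-μ e)) ⟨e₁, by simp [he₁, hneg₁]⟩
  simp only [Finset.mem_filter, and_imp] at he₀ hmin
  set θ := l e₀ / (-μ e₀) with hθ
  have hθ0 : 0 < θ := div_pos (hpos _ he₀.1) (by linarith [he₀.2])
  set l' : V → ℝ := fun e => l e + θ * μ e with hl'
  have hl'0 : ∀ e ∈ t, 0 ≤ l' e := by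
    intro e he
    rcases lt_or_ge (μ e) 0 with h | h
    · have := hmin e he h
      rw [le_div_iff₀ (by linarith)] at this
      simp only [hl']; linarith
    · have := hpos e he
      simp only [hl']; positivity
  have hl'e : l' e₀ = 0 := by
    have : μ e₀ ≠ 0 := he₀.2.ne
    simp only [hl', hθ]; field_simp; ring
  set t' := t.filter fun e => 0 < l' e
  have hsum : ∀ {M : Type _} [AddCommMonoid M] (F : V → M), (∀ e, l' e = 0 → F e = 0) →
      ∑ e ∈ t', F e = ∑ e ∈ t, F e := by
    intro M _ F hF
    refine Finset.sum_subset (Finset.filter_subset _ _) fun e he he' => hF e ?_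
    simp only [t', Finset.mem_filter, he, true_and, not_lt] at he'
    exact le_antisymm he' (hl'0 e he)
  have hsumV : ∑ e ∈ t', l' e • e = ∑ e ∈ t, l' e • e := by
    refine Finset.sum_subset (Finset.filter_subset _ _) fun e he he' => ?_
    simp only [t', Finset.mem_filter, he, true_and, not_lt] at he'
    rw [le_antisymm he' (hl'0 e he), zero_smul]
  have hcard : t'.card < k := by
    rw [← hk]
    apply Finset.card_lt_card
    refine ⟨Finset.filter_subset _ _, fun h => ?_⟩
    have := h he₀.1
    simp [t', hl'e] at this
  obtain ⟨t'', l'', hsub, rest⟩ := ih t'.card hcard t' l' rfl (fun e he => (Finset.mem_filter.1 he).2)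
    (by
      rw [hsum l' fun _ h => h]
      simp only [hl', Finset.sum_add_distrib, ← Finset.mul_sum, hμ1, h1]; simp)
    (by
      rw [hsumV]
      simp only [hl', add_smul, mul_smul, Finset.sum_add_distrib, ← Finset.smul_sum, hμ0, h0]; simp)
    (by
      rw [hsum (fun e => l' e * s e) fun e h => by simp [h]]
      simp only [hl', add_mul, mul_assoc, Finset.sum_add_distrib, ← Finset.mul_sum]
      positivity)
  exact ⟨t'', l'', hsub.trans (Finset.filter_subset _ _), rest⟩

variable {E : Type*} [NormedAddCommGroup E] [InnerProductSpace ℝ E] [FiniteDimensional ℝ E]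

/-- If no translation makes the continuous positively homogeneous function `s` negative on the unit
sphere, then there are at most `dim E + 1` nonzero vectors summing to zero on which the sum of `s`
is nonnegative. -/
theorem exists_sum_eq_zero_of_forall_exists_nonneg {s : E → ℝ} (hs : Continuous s)
    (hhom : ∀ t : ℝ, 0 ≤ t → ∀ f, s (t • f) = t * s f)
    (h : ∀ w : E, ∃ f : E, ‖f‖ = 1 ∧ 0 ≤ s f + inner ℝ f w) :
    ∃ (m : ℕ) (f : Fin m → E), 0 < m ∧ m ≤ Module.finrank ℝ E + 1 ∧ (∀ j, f j ≠ 0) ∧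
      ∑ j, f j = 0 ∧ 0 ≤ ∑ j, s (f j) := by
  classical
  -- If the hull of the graph of `s` over the sphere missed the ray `{0} × [0, ∞)`, a separating
  -- hyperplane with slope `w / τ` would give a translation making `s` negative, against `h`.
  set D : Set (E × ℝ) := (fun f => (f, s f)) '' Metric.sphere (0 : E) 1
  have hD : IsCompact (convexHull ℝ D) :=
    ((isCompact_sphere (0 : E) 1).image (by fun_prop)).convexHull_of_finiteDimensional
  set Z : Set (E × ℝ) := {0} ×ˢ Set.Ici 0
  have hZ : Convex ℝ Z := (convex_singleton _).prod (convex_Ici 0)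
  have hZc : IsClosed Z := isClosed_singleton.prod isClosed_Ici
  have hnd : ¬ Disjoint (convexHull ℝ D) Z := by
    intro hdisj
    obtain ⟨F, u, u', h1, huu, h2⟩ :=
      geometric_hahn_banach_compact_closed (convex_convexHull ℝ D) hD hZ hZc hdisj
    set w := (InnerProductSpace.toDual ℝ E).symm (F.comp (ContinuousLinearMap.inl ℝ _ _)) with hw
    set τ := F (0, 1) with hτ
    have hF : ∀ f a, F (f, a) = inner ℝ f w + a * τ := by
      intro f a
      rw [real_inner_comm, hw, InnerProductSpace.toDual_symm_apply, hτ, ← smul_eq_mul, ← map_smul]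
      simp [← map_add]
    have hu0 : u < 0 := by
      have := h2 (0, 0) ⟨rfl, le_refl (0 : ℝ)⟩
      rw [hF] at this
      simp at this
      linarith
    have hneg : ∀ f, ‖f‖ = 1 → inner ℝ f w + s f * τ < 0 := by
      intro f hf
      have := h1 _ (subset_convexHull ℝ _ ⟨f, by simpa using hf, rfl⟩)
      rw [hF] at this
      linarith
    have hτ0 : 0 ≤ τ := by
      by_contra hτn
      push Not at hτn
      have := h2 (0, u' / τ + 1) ⟨rfl, ?_⟩
      · rw [hF] at this
        simp only [inner_zero_left, zero_add, add_mul, div_mul_cancel₀ _ hτn.ne] at this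
        linarith
      · by_contra hneg'
        simp only [Set.mem_Ici, not_le] at hneg'
        have h3 : 0 < u' / τ ∨ u' / τ ≤ 0 := lt_or_ge _ _
        have h4 := h2 (0, 0) ⟨rfl, le_refl (0 : ℝ)⟩
        rw [hF] at h4
        simp at h4
        have : 0 < u' / τ := div_pos_of_neg_of_neg h4 hτn
        linarith
    -- A vertical hyperplane (`τ = 0`) is impossible, since `⟪·, w⟫` cannot be negative at both `f`
    -- and `-f`.
    rcases hτ0.eq_or_lt with h0 | h0
    · obtain ⟨f, hf, _⟩ := h 0
      have a := hneg f hf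
      have b := hneg (-f) (by simpa using hf)
      rw [← h0] at a b
      simp at a b
      linarith
    · obtain ⟨f, hf, hf'⟩ := h (τ⁻¹ • w)
      have a := hneg f hf
      rw [inner_smul_right] at hf'
      have : 0 ≤ τ * (s f + τ⁻¹ * inner ℝ f w) := mul_nonneg h0.le hf'
      rw [mul_add, mul_inv_cancel_left₀ h0.ne'] at this
      linarith
  obtain ⟨⟨z, a⟩, hz, rfl, ha⟩ := Set.not_disjoint_iff.1 hnd
  rw [convexHull_eq_union_convexHull_finite_subsets] at hz
  simp only [Set.mem_iUnion] at hz
  obtain ⟨t, htD, hzt⟩ := hz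
  rw [Finset.mem_convexHull'] at hzt
  obtain ⟨l, hl0, hl1, hlz⟩ := hzt
  have hgr : ∀ q ∈ t, ‖q.1‖ = 1 ∧ (q.1, s q.1) = q := by
    intro q hq
    obtain ⟨f, hf, rfl⟩ := htD hq
    exact ⟨by simpa using hf, rfl⟩
  set t₁ := t.filter fun q => 0 < l q with ht₁
  have hl1' : ∑ q ∈ t₁, l q = 1 := by
    rw [← hl1]
    refine Finset.sum_subset (Finset.filter_subset _ _) fun e he he' => ?_
    simp only [ht₁, Finset.mem_filter, he, true_and, not_lt] at he'
    exact le_antisymm he' (hl0 e he)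
  have hlz' : ∑ q ∈ t₁, l q • q = (0, a) := by
    rw [← hlz]
    refine Finset.sum_subset (Finset.filter_subset _ _) fun e he he' => ?_
    simp only [ht₁, Finset.mem_filter, he, true_and, not_lt] at he'
    rw [le_antisymm he' (hl0 e he), zero_smul]
  have hgr₁ : ∀ q ∈ t₁, ‖q.1‖ = 1 ∧ (q.1, s q.1) = q := fun q hq =>
    hgr q (Finset.mem_filter.1 hq).1
  have hinj : Set.InjOn Prod.fst (t₁ : Set (E × ℝ)) := by
    intro q hq q' hq' he
    rw [← (hgr₁ q hq).2, ← (hgr₁ q' hq').2, he]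
  obtain ⟨t', l', hsub, hcard, hpos', h1', h0', hs'⟩ := exists_reduced_convex_relation s _
    (t₁.image Prod.fst) (fun f => l (f, s f)) rfl
    (by
      intro e he
      obtain ⟨q, hq, rfl⟩ := Finset.mem_image.1 he
      rw [(hgr₁ q hq).2]
      exact (Finset.mem_filter.1 hq).2)
    (by
      rw [Finset.sum_image hinj, ← hl1']
      exact Finset.sum_congr rfl fun q hq => by rw [(hgr₁ q hq).2])
    (by
      rw [Finset.sum_image hinj]
      have := congrArg Prod.fst hlz'
      simp only [Prod.fst_sum, Prod.smul_fst] at this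
      rw [← this]
      exact Finset.sum_congr rfl fun q hq => by rw [(hgr₁ q hq).2])
    (by
      rw [Finset.sum_image hinj]
      have := congrArg Prod.snd hlz'
      simp only [Prod.snd_sum, Prod.smul_snd, smul_eq_mul] at this
      rw [Set.mem_Ici, ← this] at ha
      refine ha.trans_eq (Finset.sum_congr rfl fun q hq => ?_)
      rw [(hgr₁ q hq).2, show s q.1 = q.2 from congrArg Prod.snd (hgr₁ q hq).2])
  -- Positive homogeneity of `s` lets the convex weights be absorbed into the vectors.
  refine ⟨t'.card, fun j => l' (t'.equivFin.symm j) • (t'.equivFin.symm j : E), ?_, hcard,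
    fun j => ?_, ?_, ?_⟩
  · rw [Finset.card_pos]
    by_contra hne
    rw [Finset.not_nonempty_iff_eq_empty] at hne
    simp [hne] at h1'
  · have hm := (t'.equivFin.symm j).2
    obtain ⟨q, hq, hqe⟩ := Finset.mem_image.1 (hsub hm)
    refine smul_ne_zero (hpos' _ hm).ne' ?_
    rw [← hqe, ← norm_ne_zero_iff, (hgr₁ q hq).1]
    exact one_ne_zero
  · rw [Equiv.sum_comp t'.equivFin.symm fun e => l' e • (e : E), ← h0']
    exact Finset.sum_coe_sort t' fun e => l' e • e
  · rw [Equiv.sum_comp t'.equivFin.symm fun e => s (l' e • (e : E)),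
      Finset.sum_coe_sort t' fun e => s (l' e • (e : E))]
    refine hs'.trans_eq (Finset.sum_congr rfl fun e he => ?_)
    rw [hhom _ (hpos' e he).le]

end Obstruction

/-! ### Rigidity of approximate John decompositions -/

section ApproximateDecomposition

variable {E : Type*} [NormedAddCommGroup E] [InnerProductSpace ℝ E]

/-- Fewer than `dim E + 1` vectors lie in a common hyperplane. -/
theorem exists_ne_zero_forall_inner_eq [FiniteDimensional ℝ E] {J : Type*} (Y : J → E) (T : Finset J) (hT : T.Nonempty)
    (hcard : T.card ≤ Module.finrank ℝ E) :
    ∃ (z : E) (s : ℝ), z ≠ 0 ∧ ∀ j ∈ T, inner ℝ (Y j) z = s := by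
  -- The map `(z, s) ↦ (⟪Y j, z⟫ - s)` has a kernel by dimension count, the level `s` supplying the
  -- extra dimension.
  let Φ : (E × ℝ) →ₗ[ℝ] (T → ℝ) :=
    LinearMap.pi fun j => ((innerSL ℝ (Y j) : E →L[ℝ] ℝ) : E →ₗ[ℝ] ℝ).comp (LinearMap.fst ℝ E ℝ)
      - LinearMap.snd ℝ E ℝ
  have hker : LinearMap.ker Φ ≠ ⊥ := by
    apply LinearMap.ker_ne_bot_of_finrank_lt
    simp
    omega
  obtain ⟨⟨z, s⟩, hz, hne⟩ := Submodule.exists_mem_ne_zero_of_ne_bot hker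
  have h : ∀ j ∈ T, inner ℝ (Y j) z = s := by
    intro j hj
    have := congrFun (LinearMap.mem_ker.1 hz) ⟨j, hj⟩
    simpa [Φ, sub_eq_zero] using this
  refine ⟨z, s, fun h0 => hne ?_, h⟩
  obtain ⟨j, hj⟩ := hT
  have := h j hj
  simp [h0] at this
  simp [h0, ← this]

variable {ι J : Type*} [Fintype ι] [Fintype J]

/-- Data of an approximate John decomposition: the dual vectors `y i` are, in quadratic mean with
respect to the weights `c i * b i j`, within `τ` of the vectors `Y j`; the radius bound is `ρ`. -/
structure IsApproxDecomposition (ρ τ : ℝ) (c : ι → ℝ) (x y : ι → E) (b : ι → J → ℝ) (Y : J → E) :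
    Prop where
  rho_pos : 0 < ρ
  rho_sq : ρ ^ 2 = (Module.finrank ℝ E : ℝ)
  tau_nonneg : 0 ≤ τ
  tau_le : 4 * ρ ^ 3 * τ ≤ 1
  c_nonneg : ∀ i, 0 ≤ c i
  c_sum : ∑ i, c i = ρ ^ 2
  x_norm : ∀ i, ‖x i‖ ≤ ρ
  Y_norm : ∀ j, ‖Y j‖ ≤ ρ
  decomp : ∀ z, ∑ i, (c i * inner ℝ (y i) z) • x i = z
  c_smul_y : ∑ i, c i • y i = 0
  b_nonneg : ∀ i j, 0 ≤ b i j
  b_sum : ∀ i, ∑ j, b i j = 1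
  dist_sq : ∑ i, ∑ j, c i * b i j * ‖y i - Y j‖ ^ 2 ≤ ρ ^ 2 * τ ^ 2

namespace IsApproxDecomposition

variable {ρ τ : ℝ} {c : ι → ℝ} {x y : ι → E} {b : ι → J → ℝ} {Y : J → E}

theorem sum_mass (h : IsApproxDecomposition ρ τ c x y b Y) :
    ∑ i, ∑ j, c i * b i j = ρ ^ 2 := by
  simp [← Finset.mul_sum, h.b_sum, h.c_sum]

/-- Cauchy–Schwarz against the total mass `ρ ^ 2` passes from the quadratic to the linear mean. -/
theorem sum_dist (h : IsApproxDecomposition ρ τ c x y b Y) :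
    ∑ i, ∑ j, c i * b i j * ‖y i - Y j‖ ≤ ρ ^ 2 * τ := by
  have hm : ∀ i j, 0 ≤ c i * b i j := fun i j => mul_nonneg (h.c_nonneg i) (h.b_nonneg i j)
  have key := Finset.sum_sq_le_sum_mul_sum_of_sq_le_mul (Finset.univ : Finset (ι × J))
    (r := fun q => c q.1 * b q.1 q.2 * ‖y q.1 - Y q.2‖) (f := fun q => c q.1 * b q.1 q.2)
    (g := fun q => c q.1 * b q.1 q.2 * ‖y q.1 - Y q.2‖ ^ 2)
    (fun q _ => hm _ _) (fun q _ => mul_nonneg (hm _ _) (sq_nonneg _)) (fun q _ => le_of_eq (by ring))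
  simp only [Fintype.sum_prod_type, h.sum_mass] at key
  have h2 : (∑ i, ∑ j, c i * b i j * ‖y i - Y j‖) ^ 2 ≤ (ρ ^ 2 * τ) ^ 2 := by
    refine key.trans ?_
    have := mul_le_mul_of_nonneg_left h.dist_sq (sq_nonneg ρ)
    linarith
  exact abs_le_of_sq_le_sq' h2 (mul_nonneg (sq_nonneg _) h.tau_nonneg) |>.2

/-- Replacing `y i` by the `Y j` in the John identity costs `∑ c i b i j ⟪y i - Y j, z⟫ x i`, which
the mean distance and `‖x i‖ ≤ ρ` control. -/
theorem norm_sub_le (h : IsApproxDecomposition ρ τ c x y b Y) (z : E) :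
    ‖z - ∑ j, inner ℝ (Y j) z • ∑ i, (c i * b i j) • x i‖ ≤ ρ ^ 3 * τ * ‖z‖ := by
  have h1 : z - ∑ j, inner ℝ (Y j) z • ∑ i, (c i * b i j) • x i
      = ∑ i, ∑ j, (c i * b i j * inner ℝ (y i - Y j) z) • x i := by
    have h2 : z = ∑ i, ∑ j, (c i * b i j * inner ℝ (y i) z) • x i := by
      conv_lhs => rw [← h.decomp z]
      refine Finset.sum_congr rfl fun i _ => ?_
      rw [← Finset.sum_smul, ← Finset.sum_mul, ← Finset.mul_sum, h.b_sum, mul_one]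
    have h3 : ∑ j, inner ℝ (Y j) z • ∑ i, (c i * b i j) • x i
        = ∑ i, ∑ j, (c i * b i j * inner ℝ (Y j) z) • x i := by
      rw [Finset.sum_comm]
      refine Finset.sum_congr rfl fun j _ => ?_
      rw [Finset.smul_sum]
      refine Finset.sum_congr rfl fun i _ => ?_
      rw [smul_smul, mul_comm]
    rw [h3]
    nth_rw 1 [h2]
    rw [← Finset.sum_sub_distrib]
    refine Finset.sum_congr rfl fun i _ => ?_
    rw [← Finset.sum_sub_distrib]
    refine Finset.sum_congr rfl fun j _ => ?_
    rw [← sub_smul, inner_sub_left]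
    ring_nf
  rw [h1]
  have h4 : ∑ i, ∑ j, c i * b i j * ‖y i - Y j‖ * (‖z‖ * ρ) ≤ ρ ^ 2 * τ * (‖z‖ * ρ) := by
    simp only [← Finset.sum_mul]
    exact mul_le_mul_of_nonneg_right h.sum_dist (mul_nonneg (norm_nonneg _) h.rho_pos.le)
  refine le_trans (le_trans (norm_sum_le _ _) (Finset.sum_le_sum fun i _ =>
    (norm_sum_le _ _).trans (Finset.sum_le_sum fun j _ => ?_))) (h4.trans_eq (by ring))
  have hm : 0 ≤ c i * b i j := mul_nonneg (h.c_nonneg i) (h.b_nonneg i j)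
  rw [norm_smul, Real.norm_eq_abs, abs_mul, abs_of_nonneg hm, ← mul_assoc, mul_assoc (c i * b i j),
    mul_assoc (c i * b i j), mul_assoc (c i * b i j)]
  refine mul_le_mul_of_nonneg_left ?_ hm
  exact mul_le_mul (abs_real_inner_le_norm _ _) (h.x_norm i) (norm_nonneg _) (by positivity)

/-- The same replacement in the centering identity `∑ c i y i = 0`. -/
theorem abs_sum_inner_le (h : IsApproxDecomposition ρ τ c x y b Y) (z : E) :
    |∑ j, (∑ i, c i * b i j) * inner ℝ (Y j) z| ≤ ρ ^ 2 * τ * ‖z‖ := by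
  have h1 : ∑ j, (∑ i, c i * b i j) * inner ℝ (Y j) z
      = -∑ i, ∑ j, c i * b i j * inner ℝ (y i - Y j) z := by
    have h2 : ∑ i, ∑ j, c i * b i j * inner ℝ (y i) z = 0 := by
      have : inner ℝ (∑ i, c i • y i) z = 0 := by rw [h.c_smul_y, inner_zero_left]
      rw [sum_inner] at this
      rw [← this]
      refine Finset.sum_congr rfl fun i _ => ?_
      rw [← Finset.sum_mul, ← Finset.mul_sum, h.b_sum, mul_one, real_inner_smul_left]
    simp only [inner_sub_left, mul_sub, Finset.sum_sub_distrib, h2, Finset.sum_mul]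
    rw [Finset.sum_comm]
    ring
  rw [h1, abs_neg]
  have h4 : ∑ i, ∑ j, c i * b i j * ‖y i - Y j‖ * ‖z‖ ≤ ρ ^ 2 * τ * ‖z‖ := by
    simp only [← Finset.sum_mul]
    exact mul_le_mul_of_nonneg_right h.sum_dist (norm_nonneg _)
  refine le_trans (le_trans (Finset.abs_sum_le_sum_abs _ _) (Finset.sum_le_sum fun i _ =>
    (Finset.abs_sum_le_sum_abs _ _).trans (Finset.sum_le_sum fun j _ => ?_))) h4
  have hm : 0 ≤ c i * b i j := mul_nonneg (h.c_nonneg i) (h.b_nonneg i j)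
  rw [abs_mul, abs_of_nonneg hm, mul_assoc (c i * b i j)]
  exact mul_le_mul_of_nonneg_left (abs_real_inner_le_norm _ _) hm

/-- The basic nondegeneracy estimate. Approximate centering bounds the common level `s` by the mass
of `k` times `|d|`, up to an error; the approximate identity then bounds `z`. The two errors add up
to at most `2 ρ ^ 3 τ ‖z‖ ≤ ‖z‖ / 2` and are absorbed. -/
theorem norm_le_of_inner_eq [DecidableEq J] (h : IsApproxDecomposition ρ τ c x y b Y) {z : E}
    {s d : ℝ} {k : J} (hz : ∀ j, j ≠ k → inner ℝ (Y j) z = s) (hk : inner ℝ (Y k) z = s + d) :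
    ‖z‖ ≤ 4 * ρ * (∑ i, c i * b i k) * |d| := by
  set B : J → ℝ := fun j => ∑ i, c i * b i j with hB
  set M : J → E := fun j => ∑ i, (c i * b i j) • x i with hM
  have hm : ∀ i j, 0 ≤ c i * b i j := fun i j => mul_nonneg (h.c_nonneg i) (h.b_nonneg i j)
  have hB0 : ∀ j, 0 ≤ B j := fun j => Finset.sum_nonneg fun i _ => hm i j
  have hBs : ∑ j, B j = ρ ^ 2 := by rw [← h.sum_mass, Finset.sum_comm]
  have hMB : ∀ j, ‖M j‖ ≤ B j * ρ := by
    intro j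
    rw [hB, Finset.sum_mul]
    refine (norm_sum_le _ _).trans (Finset.sum_le_sum fun i _ => ?_)
    rw [norm_smul, Real.norm_of_nonneg (hm i j)]
    exact mul_le_mul_of_nonneg_left (h.x_norm i) (hm i j)
  have hY : ∀ j, inner ℝ (Y j) z = s + if j = k then d else 0 := by
    intro j
    split_ifs with hj
    · rw [hj, hk]
    · rw [hz j hj, add_zero]
  have h1 := h.abs_sum_inner_le z
  have h2 := h.norm_sub_le z
  have e1 : ∑ j, B j * inner ℝ (Y j) z = ρ ^ 2 * s + B k * d := by
    simp [hY, mul_add, Finset.sum_add_distrib, ← Finset.sum_mul, hBs]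
  have e2 : ∑ j, inner ℝ (Y j) z • M j = s • ∑ j, M j + d • M k := by
    simp [hY, add_smul, Finset.sum_add_distrib, ← Finset.smul_sum]
  rw [e1] at h1
  rw [e2] at h2
  have h3 : ρ ^ 2 * |s| ≤ ρ ^ 2 * τ * ‖z‖ + B k * |d| := by
    have : ρ ^ 2 * |s| = |ρ ^ 2 * s| := by rw [abs_mul, abs_of_nonneg (sq_nonneg ρ)]
    have h4 : |B k * d| = B k * |d| := by rw [abs_mul, abs_of_nonneg (hB0 k)]
    rw [this, ← h4]
    have := abs_sub (ρ ^ 2 * s + B k * d) (B k * d)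
    rw [add_sub_cancel_right] at this
    linarith
  have h5 : ‖s • ∑ j, M j + d • M k‖ ≤ |s| * (ρ ^ 2 * ρ) + |d| * (B k * ρ) := by
    refine (norm_add_le _ _).trans (add_le_add ?_ ?_)
    · rw [norm_smul, Real.norm_eq_abs]
      refine mul_le_mul_of_nonneg_left ?_ (abs_nonneg _)
      rw [← hBs, Finset.sum_mul]
      exact (norm_sum_le _ _).trans (Finset.sum_le_sum fun j _ => hMB j)
    · rw [norm_smul, Real.norm_eq_abs]
      exact mul_le_mul_of_nonneg_left (hMB k) (abs_nonneg _)
  have h6 : ‖z‖ ≤ ‖s • ∑ j, M j + d • M k‖ + ρ ^ 3 * τ * ‖z‖ := by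
    have := norm_sub_norm_le z (s • ∑ j, M j + d • M k)
    linarith
  have h7 : ρ * (ρ ^ 2 * |s|) ≤ ρ * (ρ ^ 2 * τ * ‖z‖ + B k * |d|) :=
    mul_le_mul_of_nonneg_left h3 h.rho_pos.le
  have h8 : 4 * ρ ^ 3 * τ * ‖z‖ ≤ 1 * ‖z‖ := mul_le_mul_of_nonneg_right h.tau_le (norm_nonneg _)
  change ‖z‖ ≤ 4 * ρ * B k * |d|
  nlinarith

variable [FiniteDimensional ℝ E]

/-- With fewer vectors some nonzero `z` would pair equally with all of them; the basic estimate with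
`d = 0` excludes it. -/
theorem card_eq [Nontrivial E] (h : IsApproxDecomposition ρ τ c x y b Y)
    (hJ : Fintype.card J ≤ Module.finrank ℝ E + 1) :
    Fintype.card J = Module.finrank ℝ E + 1 := by
  classical
  by_contra hne
  have hcard : Fintype.card J ≤ Module.finrank ℝ E := by omega
  have hpos : ∑ i, ∑ j, c i * b i j ≠ 0 := by rw [h.sum_mass]; exact (pow_pos h.rho_pos 2).ne'
  obtain ⟨i, -, hi⟩ := Finset.exists_ne_zero_of_sum_ne_zero hpos
  obtain ⟨k, -, -⟩ := Finset.exists_ne_zero_of_sum_ne_zero hi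
  obtain ⟨z, s, hz, hzs⟩ := exists_ne_zero_forall_inner_eq Y Finset.univ ⟨k, Finset.mem_univ k⟩ hcard
  have := h.norm_le_of_inner_eq (z := z) (s := s) (d := 0) (k := k) (fun j _ => hzs j (by simp))
    (by rw [hzs k (by simp), add_zero])
  simp at this
  exact hz this

/-- Take `z` at a common level on all `Y` but `Y k`. Then `d = ⟪Y k - Y j, z⟫`, and `‖z‖` cancels
from the basic estimate. A lower bound for the mass and one for the separation both follow. -/
theorem one_le_mass_mul_norm_sub [Nontrivial E] (h : IsApproxDecomposition ρ τ c x y b Y)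
    (hJ : Fintype.card J ≤ Module.finrank ℝ E + 1) {k j : J} (hjk : j ≠ k) :
    1 ≤ 4 * ρ * (∑ i, c i * b i k) * ‖Y k - Y j‖ := by
  classical
  obtain ⟨z, s, hz, hzs⟩ := exists_ne_zero_forall_inner_eq Y (Finset.univ.erase k)
    ⟨j, by simp [hjk]⟩ (by rw [Finset.card_erase_of_mem (Finset.mem_univ k), Finset.card_univ]; omega)
  have h1 := h.norm_le_of_inner_eq (z := z) (s := s) (d := inner ℝ (Y k) z - s) (k := k)
    (fun j hj => hzs j (by simp [hj])) (by ring)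
  have h2 : |inner ℝ (Y k) z - s| ≤ ‖Y k - Y j‖ * ‖z‖ := by
    rw [← hzs j (by simp [hjk]), ← inner_sub_left]
    exact abs_real_inner_le_norm _ _
  have hB0 : 0 ≤ ∑ i, c i * b i k :=
    Finset.sum_nonneg fun i _ => mul_nonneg (h.c_nonneg i) (h.b_nonneg i k)
  have hzn : 0 < ‖z‖ := norm_pos_iff.2 hz
  have h3 : 1 * ‖z‖ ≤ 4 * ρ * (∑ i, c i * b i k) * ‖Y k - Y j‖ * ‖z‖ := by
    rw [one_mul, mul_assoc _ _ ‖z‖]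
    exact h1.trans (mul_le_mul_of_nonneg_left h2
      (mul_nonneg (mul_nonneg (by norm_num) h.rho_pos.le) hB0))
  exact le_of_mul_le_mul_right h3 hzn

theorem one_le_mass [Nontrivial E] (h : IsApproxDecomposition ρ τ c x y b Y)
    (hJ : Fintype.card J ≤ Module.finrank ℝ E + 1) (k : J) :
    1 ≤ 8 * ρ ^ 2 * ∑ i, c i * b i k := by
  have hc := h.card_eq hJ
  have : 0 < Module.finrank ℝ E := Module.finrank_pos
  obtain ⟨j, hj⟩ := Fintype.exists_ne_of_one_lt_card (by omega) k
  have h1 := h.one_le_mass_mul_norm_sub hJ hj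
  have h2 : ‖Y k - Y j‖ ≤ 2 * ρ := by
    have := _root_.norm_sub_le (Y k) (Y j)
    linarith [h.Y_norm k, h.Y_norm j]
  have hB0 : 0 ≤ ∑ i, c i * b i k :=
    Finset.sum_nonneg fun i _ => mul_nonneg (h.c_nonneg i) (h.b_nonneg i k)
  have := mul_le_mul_of_nonneg_left h2
    (mul_nonneg (mul_nonneg (by norm_num : (0 : ℝ) ≤ 4) h.rho_pos.le) hB0)
  nlinarith

theorem one_le_norm_sub [Nontrivial E] (h : IsApproxDecomposition ρ τ c x y b Y)
    (hJ : Fintype.card J ≤ Module.finrank ℝ E + 1) {k j : J} (hjk : j ≠ k) :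
    1 ≤ 4 * ρ ^ 3 * ‖Y k - Y j‖ := by
  have h1 := h.one_le_mass_mul_norm_sub hJ hjk
  have h2 : ∑ i, c i * b i k ≤ ρ ^ 2 := by
    rw [← h.sum_mass, Finset.sum_comm]
    exact Finset.single_le_sum (f := fun j => ∑ i, c i * b i j)
      (fun j _ => Finset.sum_nonneg fun i _ => mul_nonneg (h.c_nonneg i) (h.b_nonneg i j))
      (Finset.mem_univ k)
  have h3 : 0 ≤ 4 * ρ * ‖Y k - Y j‖ := by have := h.rho_pos; positivity
  have := mul_le_mul_of_nonneg_left h2 h3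
  nlinarith

/-- Since the `Y j` are `1 / (4 ρ ^ 3)`-separated, each `y i` is at distance at least `1 / (8 ρ ^
3)` from `Y j` or from all the others. So `b (1 - b)` is at most the weight on far vectors, which a
Chebyshev estimate bounds by the quadratic mean. -/
theorem sum_mass_mul_one_sub_le [Nontrivial E] (h : IsApproxDecomposition ρ τ c x y b Y)
    (hJ : Fintype.card J ≤ Module.finrank ℝ E + 1) (j : J) :
    ∑ i, c i * b i j * (1 - b i j) ≤ 64 * ρ ^ 8 * τ ^ 2 := by
  classical
  have key : ∀ i, b i j * (1 - b i j) ≤ ∑ k, b i k * (64 * ρ ^ 6 * ‖y i - Y k‖ ^ 2) := by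
    intro i
    have hρ := h.rho_pos
    have hterm : ∀ k, 0 ≤ b i k * (64 * ρ ^ 6 * ‖y i - Y k‖ ^ 2) := fun k =>
      mul_nonneg (h.b_nonneg i k) (by positivity)
    have hbj : b i j ≤ 1 := by
      rw [← h.b_sum i]
      exact Finset.single_le_sum (fun k _ => h.b_nonneg i k) (Finset.mem_univ j)
    have hbig : ∀ k, 1 ≤ 8 * ρ ^ 3 * ‖y i - Y k‖ →
        b i k ≤ b i k * (64 * ρ ^ 6 * ‖y i - Y k‖ ^ 2) := by
      intro k hk
      refine le_mul_of_one_le_right (h.b_nonneg i k) ?_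
      calc (1 : ℝ) ≤ (8 * ρ ^ 3 * ‖y i - Y k‖) ^ 2 := one_le_pow₀ hk
        _ = _ := by ring
    rcases le_or_gt 1 (8 * ρ ^ 3 * ‖y i - Y j‖) with hj | hj
    · refine le_trans ?_ (Finset.single_le_sum (fun k _ => hterm k) (Finset.mem_univ j))
      refine le_trans ?_ (hbig j hj)
      nlinarith [h.b_nonneg i j]
    · have h1 : b i j * (1 - b i j) ≤ ∑ k ∈ Finset.univ.erase j, b i k := by
        have : ∑ k ∈ Finset.univ.erase j, b i k = 1 - b i j := by
          rw [← h.b_sum i, ← Finset.add_sum_erase _ _ (Finset.mem_univ j), add_sub_cancel_left]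
        rw [this]
        nlinarith [h.b_nonneg i j]
      refine h1.trans (le_trans (Finset.sum_le_sum fun k hk => hbig k ?_)
        (Finset.sum_le_sum_of_subset_of_nonneg (Finset.erase_subset _ _) fun k _ _ => hterm k))
      have h2 := h.one_le_norm_sub hJ (Finset.ne_of_mem_erase hk)
      have h3 : ‖Y j - Y k‖ ≤ ‖y i - Y j‖ + ‖y i - Y k‖ := by
        rw [← norm_neg (y i - Y j)]
        refine le_trans (le_of_eq ?_) (norm_add_le _ _)
        congr 1
        abel
      have h4 := mul_le_mul_of_nonneg_left h3 (by positivity : 0 ≤ 4 * ρ ^ 3)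
      linarith
  calc ∑ i, c i * b i j * (1 - b i j)
      ≤ ∑ i, 64 * ρ ^ 6 * ∑ k, c i * b i k * ‖y i - Y k‖ ^ 2 := by
        refine Finset.sum_le_sum fun i _ => ?_
        rw [mul_assoc]
        refine (mul_le_mul_of_nonneg_left (key i) (h.c_nonneg i)).trans_eq ?_
        rw [Finset.mul_sum, Finset.mul_sum]
        exact Finset.sum_congr rfl fun k _ => by ring
    _ = 64 * ρ ^ 6 * ∑ i, ∑ k, c i * b i k * ‖y i - Y k‖ ^ 2 := by rw [Finset.mul_sum]
    _ ≤ 64 * ρ ^ 6 * (ρ ^ 2 * τ ^ 2) := mul_le_mul_of_nonneg_left h.dist_sq (by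
        have := h.rho_pos; positivity)
    _ = _ := by ring

end IsApproxDecomposition

end ApproximateDecomposition

/-! ### From barycentric coordinates to distance from a simplex -/

section SimplexApproximation

/-- If the points `q j` have barycentric coordinates close to those of the vertices `p j`, then
their convex hull contains all points whose barycentric coordinates are not too small. -/
theorem sum_smul_mem_convexHull_of_one_sub_le {E J : Type*} [NormedAddCommGroup E]
    [NormedSpace ℝ E] [Fintype J] [Nonempty J] (p : J → E) {Q : J → J → ℝ} {κ : ℝ}
    (hQ0 : ∀ j k, 0 ≤ Q j k) (hQ1 : ∀ j, ∑ k, Q j k = 1) (hQκ : ∀ j, 1 - Q j j ≤ κ)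
    {w : J → ℝ} (hκ0 : 0 ≤ κ) (hw : ∀ k, κ ≤ w k) (hw1 : ∑ k, w k = 1) :
    ∑ k, w k • p k ∈ convexHull ℝ (Set.range fun j => ∑ k, Q j k • p k) := by
  classical
  by_contra hmem
  have hfin : (Set.range fun j => ∑ k, Q j k • p k).Finite := Set.finite_range _
  obtain ⟨F, u, h1, h2⟩ := geometric_hahn_banach_closed_point (convex_convexHull ℝ _)
    (hfin.isClosed_convexHull ℝ) hmem
  -- For a separating `F` with maximum at `p a` and minimum at `p b`, the point with index `a` loses
  -- at most `κ (F (p a) - F (p b))` from the maximum, while the target loses at least that much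
  -- through its weight at `b`.
  obtain ⟨a, -, ha⟩ := Finset.exists_max_image (Finset.univ : Finset J) (fun k => F (p k))
    Finset.univ_nonempty
  obtain ⟨b, -, hb⟩ := Finset.exists_min_image (Finset.univ : Finset J) (fun k => F (p k))
    Finset.univ_nonempty
  have hab : F (p b) ≤ F (p a) := hb a (Finset.mem_univ _)
  have h3 : F (∑ k, Q a k • p k) < u := h1 _ (subset_convexHull ℝ _ ⟨a, rfl⟩)
  have h4 : F (p a) - κ * (F (p a) - F (p b)) ≤ F (∑ k, Q a k • p k) := by
    have h5 : F (∑ k, Q a k • p k) - F (p b)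
        = ∑ k, Q a k * (F (p k) - F (p b)) := by
      simp [mul_sub, Finset.sum_sub_distrib, ← Finset.sum_mul, hQ1]
    have h6 : Q a a * (F (p a) - F (p b)) ≤ ∑ k, Q a k * (F (p k) - F (p b)) :=
      Finset.single_le_sum (f := fun k => Q a k * (F (p k) - F (p b)))
        (fun k _ => mul_nonneg (hQ0 a k) (sub_nonneg.2 (hb k (Finset.mem_univ _))))
        (Finset.mem_univ a)
    nlinarith [hQκ a]
  have h7 : F (∑ k, w k • p k) ≤ F (p a) - κ * (F (p a) - F (p b)) := by
    have h5 : F (p a) - F (∑ k, w k • p k) = ∑ k, w k * (F (p a) - F (p k)) := by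
      simp [mul_sub, Finset.sum_sub_distrib, ← Finset.sum_mul, hw1]
    have h6 : w b * (F (p a) - F (p b)) ≤ ∑ k, w k * (F (p a) - F (p k)) :=
      Finset.single_le_sum (f := fun k => w k * (F (p a) - F (p k)))
        (fun k _ => mul_nonneg (hκ0.trans (hw k)) (sub_nonneg.2 (ha k (Finset.mem_univ _))))
        (Finset.mem_univ b)
    nlinarith [hw b]
  linarith

theorem banachMazurDist_le {E : Type*} [AddCommGroup E] [Module ℝ E] {K L : Set E} {r : ℝ}
    (hr : 0 < r) (T : E ≃ₗ[ℝ] E) (u v : E) (h1 : K + {u} ⊆ T '' (L + {v}))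
    (h2 : T '' (L + {v}) ⊆ r • (K + {u})) : banachMazurDist K L ≤ r :=
  csInf_le ⟨0, fun _ h => h.1.le⟩ ⟨hr, T, u, v, h1, h2⟩

/-- An affine image of `K` inside `L` with a translate of `L` inside its `r`-fold multiple bounds the
distance of `K` and `L`. -/
theorem banachMazurDist_le_of_affine {E : Type*} [AddCommGroup E] [Module ℝ E] {K L : Set E} {r : ℝ}
    (hr : 0 < r) (hr1 : r ≠ 1) (T : E ≃ₗ[ℝ] E) (v w : E) (h1 : ∀ x ∈ K, T x + v ∈ L)
    (h2 : ∀ z ∈ L, ∃ x ∈ K, z + w = r • (T x + v)) : banachMazurDist K L ≤ r := by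
  have hr1' : 1 - r ≠ 0 := sub_ne_zero.2 hr1.symm
  -- The definition uses the same `u` in both inclusions; solving `w = t - r t` splits `w` between
  -- them, which needs `r ≠ 1`.
  set t : E := (1 - r)⁻¹ • w with ht
  have htw : w = t - r • t := by
    rw [ht, ← one_smul ℝ ((1 - r)⁻¹ • w), smul_smul r, mul_one, ← sub_smul, smul_smul,
      mul_inv_cancel₀ hr1', one_smul]
  refine banachMazurDist_le hr T.symm (T.symm (v + t)) t ?_ ?_
  · rintro _ ⟨x, hx, _, rfl, rfl⟩
    refine ⟨T x + v + t, ⟨_, h1 x hx, _, rfl, rfl⟩, ?_⟩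
    apply T.injective
    simp [add_assoc]
  · rintro _ ⟨_, ⟨z, hz, _, rfl, rfl⟩, rfl⟩
    obtain ⟨x, hx, hxz⟩ := h2 z hz
    refine ⟨x + T.symm (v + t), ⟨x, hx, _, rfl, rfl⟩, ?_⟩
    apply T.injective
    simp only [map_smul, map_add, LinearEquiv.apply_symm_apply]
    rw [htw] at hxz
    have : z + t = r • (T x + v) + r • t := by rw [← hxz]; abel
    rw [this, ← smul_add, add_assoc]

/-- If the normalized barycentric functions `h j - ⟪f j, ·⟫` are nonnegative on an affine image of
`K` that nearly reaches all vertices, then `K` is close to a simplex. -/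
theorem banachMazurDist_simplex_le {E : Type*} [NormedAddCommGroup E] [InnerProductSpace ℝ E]
    [FiniteDimensional ℝ E] {n : ℕ} (hn : Module.finrank ℝ E = n) (S : Affine.Simplex ℝ E n) {K : Set E}
    (hK : Convex ℝ K) (T : E ≃ₗ[ℝ] E) (v : E) (f : Fin (n + 1) → E) (h : Fin (n + 1) → ℝ)
    (hf : ∑ j, f j = 0) (hh : ∑ j, h j = 1) {κ : ℝ} (hκ0 : 0 ≤ κ)
    (hκ : (n + 1 : ℝ) * κ ≤ 1 / 2) (hb : ∀ x ∈ K, ∀ j, 0 ≤ h j - inner ℝ (f j) (T x + v))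
    (X : Fin (n + 1) → E) (hX : ∀ j, X j ∈ K)
    (hXκ : ∀ j, 1 - (h j - inner ℝ (f j) (T (X j) + v)) ≤ κ) :
    banachMazurDist K (convexHull ℝ (Set.range S.points)) ≤ 1 + 2 * ((n + 1 : ℝ) * κ) := by
  classical
  set p := S.points
  -- `z ↦ L₀ z + q₀` sends `z` to the point with barycentric coordinates `h j - ⟪f j, z⟫` in the
  -- target simplex.
  set L₀ : E →ₗ[ℝ] E := -∑ j, ((innerSL ℝ (f j) : E →L[ℝ] ℝ) : E →ₗ[ℝ] ℝ).smulRight (p j) with hL₀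
  set q₀ : E := ∑ j, h j • p j with hq₀
  have hφ : ∀ z, L₀ z + q₀ = ∑ j, (h j - inner ℝ (f j) z) • p j := by
    intro z
    simp only [hL₀, hq₀, LinearMap.neg_apply, LinearMap.sum_apply, sub_smul,
      Finset.sum_sub_distrib, LinearMap.smulRight_apply, ContinuousLinearMap.coe_coe,
      innerSL_apply_apply]
    abel
  have hsum : ∀ z, ∑ j, (h j - inner ℝ (f j) z) = 1 := by
    intro z
    rw [Finset.sum_sub_distrib, hh, ← sum_inner, hf, inner_zero_left, sub_zero]
  set C : Set E := convexHull ℝ (Set.range fun j => L₀ (T (X j) + v) + q₀) with hC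
  have hmemC : ∀ w : Fin (n + 1) → ℝ, (∀ k, κ ≤ w k) → ∑ k, w k = 1 → ∑ k, w k • p k ∈ C := by
    intro w hw hw1
    simp only [hC, hφ]
    exact sum_smul_mem_convexHull_of_one_sub_le p
      (Q := fun j k => h k - inner ℝ (f k) (T (X j) + v))
      (fun j k => hb _ (hX j) k) (fun j => hsum _) hXκ hκ0 hw hw1
  have hN : (0 : ℝ) < n + 1 := by positivity
  have hC1 : C ⊆ (fun x => L₀ (T x + v) + q₀) '' K := by
    refine convexHull_min ?_ ?_
    · rintro _ ⟨j, rfl⟩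
      exact ⟨X j, hX j, rfl⟩
    · rintro _ ⟨x, hx, rfl⟩ _ ⟨x', hx', rfl⟩ a b ha hb hab
      refine ⟨a • x + b • x', hK hx hx' ha hb hab, ?_⟩
      have hv : v = a • v + b • v := by rw [← add_smul, hab, one_smul]
      have hq : q₀ = a • q₀ + b • q₀ := by rw [← add_smul, hab, one_smul]
      simp only [map_add, map_smul]
      nth_rw 1 [hv, hq]
      simp only [map_add, map_smul, smul_add]
      abel
  set c : E := ∑ k, (n + 1 : ℝ)⁻¹ • p k with hc
  have hκN : κ ≤ (n + 1 : ℝ)⁻¹ := by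
    rw [← one_div, le_div_iff₀ hN]; linarith
  have hcsum : ∑ _k : Fin (n + 1), (n + 1 : ℝ)⁻¹ = 1 := by
    simp; field_simp
  have hcC : c ∈ C := hmemC _ (fun _ => hκN) hcsum
  have hrange : ∀ a ∈ C, ∀ b ∈ C, a - b ∈ LinearMap.range L₀ := by
    intro a ha b hb
    obtain ⟨x, -, rfl⟩ := hC1 ha
    obtain ⟨y, -, rfl⟩ := hC1 hb
    exact ⟨(T x + v) - (T y + v), by simp only [map_sub]; abel⟩
  -- Invertibility is deduced from the size of `C`: it contains the centroid `c` and `c + θ (p k - p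
  -- 0)`, whose coordinates stay at least `κ` because `(n + 1) κ ≤ 1 / 2`.
  have hsurj : LinearMap.range L₀ = ⊤ := by
    rw [eq_top_iff, ← S.independent.vectorSpan_eq_top_of_card_eq_finrank_add_one (by simp [hn]),
      vectorSpan_range_eq_span_range_vsub_right ℝ S.points 0, Submodule.span_le]
    rintro _ ⟨k, rfl⟩
    rcases eq_or_ne k 0 with rfl | hk
    · simp
    set θ : ℝ := (n + 1 : ℝ)⁻¹ / 2
    have hθ : 0 < θ := by positivity
    have hκθ : κ ≤ (n + 1 : ℝ)⁻¹ - θ := by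
      have : (n + 1 : ℝ)⁻¹ - θ = (1 / 2) / (n + 1) := by simp only [θ]; field_simp; norm_num
      rw [this, le_div_iff₀ hN]; linarith
    have hdC := hmemC (fun i => (n + 1 : ℝ)⁻¹ + ((if i = k then θ else 0) - if i = 0 then θ else 0))
      (by
        intro i
        split_ifs <;> linarith)
      (by simp only [Finset.sum_add_distrib, hcsum, Finset.sum_sub_distrib]; simp)
    have := hrange _ hdC _ hcC
    simp only [add_smul, sub_smul, Finset.sum_add_distrib, Finset.sum_sub_distrib, hc,
      add_sub_cancel_left] at this
    simp only [ite_smul, zero_smul, Finset.sum_ite_eq', Finset.mem_univ, if_true, ← smul_sub] at this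
    have h2 := (LinearMap.range L₀).smul_mem θ⁻¹ this
    rwa [smul_smul, inv_mul_cancel₀ hθ.ne', one_smul] at h2
  set e : E ≃ₗ[ℝ] E := LinearEquiv.ofBijective L₀
    ⟨LinearMap.injective_iff_surjective.2 (LinearMap.range_eq_top.1 hsurj),
      LinearMap.range_eq_top.1 hsurj⟩ with he
  have heL : ∀ z, e z = L₀ z := fun z => rfl
  set Ψ := T.trans e
  set q : E := L₀ v + q₀
  have hΨ : ∀ x, L₀ (T x + v) + q₀ = Ψ x + q := by
    intro x
    simp [Ψ, q, heL, add_assoc]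
  set s : ℝ := (n + 1 : ℝ) * κ with hs
  have hs0 : 0 ≤ s := by positivity
  have hs1 : 0 < 1 - s := by linarith
  -- Shrinking the simplex by `1 - s` about its centroid makes all coordinates at least `s / (n + 1)
  -- = κ`, so it lands in `C`.
  have hle : banachMazurDist K (convexHull ℝ (Set.range p)) ≤ (1 - s)⁻¹ := by
    refine banachMazurDist_le (inv_pos.2 hs1) Ψ.symm (Ψ.symm (q - c)) (-c) ?_ ?_
    · rintro _ ⟨x, hx, _, rfl, rfl⟩
      refine ⟨Ψ x + q + -c, ⟨_, ?_, _, rfl, rfl⟩, ?_⟩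
      · rw [← hΨ, hφ]
        exact (convex_convexHull ℝ _).sum_mem (fun j _ => hb x hx j) (hsum _)
          fun j _ => subset_convexHull ℝ _ ⟨j, rfl⟩
      · apply Ψ.injective
        simp only [map_add, LinearEquiv.apply_symm_apply]
        abel
    · rintro _ ⟨_, ⟨z, hz, _, rfl, rfl⟩, rfl⟩
      have hconv : Convex ℝ {z | (1 - s) • z + s • c ∈ C} := by
        intro z₁ h₁ z₂ h₂ a b ha hb hab
        have := convex_convexHull ℝ _ h₁ h₂ ha hb hab
        rw [Set.mem_ofPred_eq]
        convert this using 1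
        have hcab : s • c = a • (s • c) + b • (s • c) := by rw [← add_smul, hab, one_smul]
        nth_rw 1 [hcab]
        simp only [smul_add, smul_smul, mul_comm (1 - s)]
        abel
      have hzC : (1 - s) • z + s • c ∈ C := by
        refine convexHull_min ?_ hconv hz
        rintro _ ⟨k, rfl⟩
        have := hmemC (fun i => (if i = k then 1 - s else 0) + s * (n + 1 : ℝ)⁻¹)
          (fun i => by
            have : s * (n + 1 : ℝ)⁻¹ = κ := by rw [hs]; field_simp
            rw [this]
            split_ifs <;> linarith)
          (by rw [Finset.sum_add_distrib, ← Finset.mul_sum, hcsum]; simp)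
        simpa [add_smul, Finset.sum_add_distrib, mul_smul, ← Finset.smul_sum, hc] using this
      obtain ⟨x, hx, hxz⟩ := hC1 hzC
      refine ⟨x + Ψ.symm (q - c), ⟨x, hx, _, rfl, rfl⟩, ?_⟩
      apply Ψ.injective
      simp only [map_smul, map_add, LinearEquiv.apply_symm_apply]
      simp only [hΨ] at hxz
      have h3 : Ψ x + (q - c) = (1 - s) • (z + -c) := by
        rw [← add_sub_assoc, hxz, smul_add, smul_neg, sub_smul 1 s c, one_smul]
        abel
      rw [h3, smul_smul, inv_mul_cancel₀ hs1.ne', one_smul]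
  refine hle.trans ?_
  rw [inv_le_iff_one_le_mul₀ hs1]
  nlinarith

end SimplexApproximation

/-! ### Stability under a convexity modulus of the polar -/

section Stability

variable {E : Type*} [NormedAddCommGroup E] [InnerProductSpace ℝ E]

/-- The weighted defect of the obstructing functionals in a John position. -/
theorem sum_defect_le {ι J : Type*} [Fintype ι] [Fintype J] {c : ι → ℝ} {x y : ι → E}
    {N ε : ℝ} (hdec : ∀ z, ∑ i, (c i * inner ℝ (y i) z) • x i = z) (hy : ∑ i, c i • y i = 0)
    (hc : ∑ i, c i = N) {g ξ : J → E} {h : J → ℝ} (hg : ∑ j, g j = 0) (hh : ∑ j, h j = 1)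
    (hξ : (1 - ε) * N ≤ ∑ j, inner ℝ (g j) (ξ j)) :
    ∑ i, ∑ j, c i * (h j - inner ℝ (g j) (x i)) * (1 + inner ℝ (y i) (ξ j)) ≤ ε * N := by
  have h1 : ∀ j, inner ℝ (g j) (ξ j)
      = ∑ i, c i * inner ℝ (y i) (ξ j) * inner ℝ (g j) (x i) := by
    intro j
    conv_lhs => rw [← hdec (ξ j)]
    simp [inner_sum, inner_smul_right]
  have h2 : ∀ j, ∑ i, c i * inner ℝ (y i) (ξ j) = 0 := by
    intro j
    have := congrArg (fun w => inner ℝ w (ξ j)) hy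
    simpa [sum_inner, real_inner_smul_left] using this
  have h3 : ∑ i, ∑ j, c i * inner ℝ (g j) (x i) = 0 := by
    refine Finset.sum_eq_zero fun i _ => ?_
    rw [← Finset.mul_sum, ← sum_inner, hg, inner_zero_left, mul_zero]
  have h4 : ∑ i, ∑ j, c i * h j = N := by
    simp [← Finset.mul_sum, hh, hc]
  have h5 : ∑ i, ∑ j, h j * (c i * inner ℝ (y i) (ξ j)) = 0 := by
    rw [Finset.sum_comm]
    exact Finset.sum_eq_zero fun j _ => by rw [← Finset.mul_sum, h2, mul_zero]
  -- Of the four sums in the expansion, the two mixed ones vanish by centering; the others are `N`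
  -- and, by the John identity, `∑ ⟪g j, ξ j⟫`.
  have h6 : ∑ i, ∑ j, c i * (h j - inner ℝ (g j) (x i)) * (1 + inner ℝ (y i) (ξ j))
      = ∑ i, ∑ j, c i * h j - ∑ i, ∑ j, c i * inner ℝ (g j) (x i)
        + ∑ i, ∑ j, h j * (c i * inner ℝ (y i) (ξ j))
        - ∑ i, ∑ j, c i * inner ℝ (y i) (ξ j) * inner ℝ (g j) (x i) := by
    simp only [← Finset.sum_sub_distrib, ← Finset.sum_add_distrib]
    refine Finset.sum_congr rfl fun i _ => Finset.sum_congr rfl fun j _ => ?_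
    ring
  have h7 : ∑ i, ∑ j, c i * inner ℝ (y i) (ξ j) * inner ℝ (g j) (x i)
      = ∑ j, inner ℝ (g j) (ξ j) := by
    rw [Finset.sum_comm]
    exact Finset.sum_congr rfl fun j _ => (h1 j).symm
  rw [h6, h3, h4, h5, h7]
  linarith

variable [FiniteDimensional ℝ E]

/-- The image of a convex body under an invertible affine map is a convex body. -/
theorem IsConvexBody.image_affine {K : Set E} (hK : IsConvexBody K) (T : E ≃ₗ[ℝ] E) (v : E) :
    IsConvexBody ((fun x => T x + v) '' K) := by
  let e : E ≃ₜ E := T.toContinuousLinearEquiv.toHomeomorph.trans (Homeomorph.addRight v)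
  have he : (fun x => T x + v) = e := rfl
  refine ⟨?_, ?_, ?_⟩
  · rw [he]; exact hK.isCompact.image e.continuous
  · have : (fun x => T x + v) '' K = (fun z => z + v) '' ((T : E →ₗ[ℝ] E) '' K) := by
      rw [Set.image_image]; rfl
    rw [this]
    have h := (hK.convex.linear_image (T : E →ₗ[ℝ] E)).translate v
    simpa only [add_comm] using h
  · rw [he, ← e.image_interior]; exact hK.interior_nonempty.image _

/-- If the distance of `K` and `L` is at least `r > 1`, every affine image of `K` inside `L` admits
nonzero functionals summing to zero that obstruct the inclusion of translates of `L` into the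
`r`-fold multiple. -/
theorem exists_obstruction_of_le_banachMazurDist {K L : Set E} (hK : IsConvexBody K)
    (hL : IsCompact L) (hLne : L.Nonempty) {r : ℝ} (hr : 1 < r) (hd : r ≤ banachMazurDist K L)
    (T : E ≃ₗ[ℝ] E) (v : E) (hT : ∀ x ∈ K, T x + v ∈ L) :
    ∃ (m : ℕ) (f : Fin m → E), 0 < m ∧ m ≤ Module.finrank ℝ E + 1 ∧ (∀ j, f j ≠ 0) ∧
      ∑ j, f j = 0 ∧
      r * ∑ j, supportFun ((fun x => T x + v) '' K) (f j) ≤ ∑ j, supportFun L (f j) := by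
  set K' := (fun x => T x + v) '' K with hK'
  have hK'b : IsConvexBody K' := hK.image_affine T v
  have hK'ne : K'.Nonempty := hK'b.interior_nonempty.mono interior_subset
  have hcK := continuous_supportFun hK'b.isCompact
  have hcL := continuous_supportFun hL
  obtain ⟨m, f, h0, h1, h2, h3, h4⟩ := exists_sum_eq_zero_of_forall_exists_nonneg
    (s := fun f => supportFun L f - r * supportFun K' f) (by fun_prop)
    (fun t ht f => by
      simp only [supportFun_smul hL hLne ht, supportFun_smul hK'b.isCompact hK'ne ht]; ring)
    (fun w => by
      by_contra hcon
      push Not at hcon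
      obtain ⟨M, hM⟩ := (isCompact_sphere (0 : E) 1).exists_bound_of_continuousOn hcK.continuousOn
      obtain ⟨δ, hδ, hδs⟩ : ∃ δ > 0, ∀ f : E, ‖f‖ = 1 →
          supportFun L f - r * supportFun K' f + inner ℝ f w ≤ -δ := by
        rcases (Metric.sphere (0 : E) 1).eq_empty_or_nonempty with h | h
        · refine ⟨1, one_pos, fun f hf => ?_⟩
          have : f ∈ Metric.sphere (0 : E) 1 := by simpa using hf
          rw [h] at this
          exact this.elim
        · have hc : Continuous fun f : E =>
              supportFun L f - r * supportFun K' f + inner ℝ f w := by fun_prop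
          obtain ⟨f, hf, hmax⟩ := (isCompact_sphere (0 : E) 1).exists_isMaxOn h hc.continuousOn
          refine ⟨_, neg_pos.2 (hcon f (by simpa using hf)), fun f' hf' => ?_⟩
          rw [neg_neg]
          exact hmax (show f' ∈ Metric.sphere (0 : E) 1 by simpa using hf')
      have hη : 0 < δ / (|M| + 1) := by positivity
      -- The margin `δ` allows a factor `r' < r` that still satisfies the inclusion, contradicting
      -- the lower bound on the distance; `r'` is kept above 1 for `banachMazurDist_le_of_affine`.
      obtain ⟨r', hr'1, hr'2⟩ := exists_between (max_lt hr (sub_lt_self r hη))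
      have hr'3 : 1 < r' := (le_max_left _ _).trans_lt hr'1
      have hr'4 : r - r' ≤ δ / (|M| + 1) := by
        have := (le_max_right (1 : ℝ) (r - δ / (|M| + 1))).trans_lt hr'1
        linarith
      have hr'0 : 0 < r' := by linarith
      have hunit : ∀ f : E, ‖f‖ = 1 → supportFun L f + inner ℝ f w ≤ r' * supportFun K' f := by
        intro f hf
        have a1 := hδs f hf
        have a2 : |supportFun K' f| ≤ |M| + 1 := by
          have := hM f (by simpa using hf)
          rw [Real.norm_eq_abs] at this
          linarith [le_abs_self M]
        have a3 : (r - r') * supportFun K' f ≤ δ := by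
          calc (r - r') * supportFun K' f ≤ (r - r') * (|M| + 1) :=
                mul_le_mul_of_nonneg_left ((le_abs_self _).trans a2) (by linarith)
            _ ≤ δ / (|M| + 1) * (|M| + 1) := mul_le_mul_of_nonneg_right hr'4 (by positivity)
            _ = δ := by field_simp
        linarith
      have hall : ∀ f : E, supportFun L f + inner ℝ f w ≤ r' * supportFun K' f := by
        intro f
        rcases eq_or_ne f 0 with rfl | hf
        · have e1 := supportFun_smul hL hLne le_rfl (0 : E)
          have e2 := supportFun_smul hK'b.isCompact hK'ne le_rfl (0 : E)
          simp at e1 e2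
          simp [e1, e2]
        · have hfn : 0 < ‖f‖ := norm_pos_iff.2 hf
          have a := hunit (‖f‖⁻¹ • f) (norm_smul_inv_norm hf)
          rw [supportFun_smul hL hLne (by positivity), real_inner_smul_left,
            supportFun_smul hK'b.isCompact hK'ne (by positivity)] at a
          have b := mul_le_mul_of_nonneg_left a hfn.le
          have e : ∀ c : ℝ, ‖f‖ * (‖f‖⁻¹ * c) = c := fun c => mul_inv_cancel_left₀ hfn.ne' c
          rw [mul_add, e, e, mul_left_comm, e] at b
          exact b
      have := banachMazurDist_le_of_affine (K := K) (L := L) hr'0 hr'3.ne' T v w hT fun z hz => by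
        have hmem : r'⁻¹ • (z + w) ∈ K' := by
          refine mem_of_inner_le_supportFun hK'b.isCompact hK'b.convex hK'ne fun f => ?_
          rw [inner_smul_right, inner_add_right, inv_mul_le_iff₀ hr'0]
          have := hall f
          have := inner_le_supportFun hL f hz
          linarith
        obtain ⟨x, hx, hxe⟩ := hmem
        refine ⟨x, hx, ?_⟩
        simp only at hxe
        rw [hxe, smul_smul, mul_inv_cancel₀ hr'0.ne', one_smul]
      linarith)
  refine ⟨m, f, h0, h1, h2, h3, ?_⟩
  rw [Finset.sum_sub_distrib, ← Finset.mul_sum] at h4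
  linarith

/-- Comparison of the quadratic mean with a mean of higher order. -/
theorem sum_mul_sq_le_of_sum_mul_rpow_le {A : Type*} [Fintype A] {m t : A → ℝ} {N τ s : ℝ}
    (hN : 0 < N) (hm : ∀ a, 0 ≤ m a) (hmN : ∑ a, m a = N) (ht : ∀ a, 0 ≤ t a) (hτ : 0 ≤ τ)
    (hs : 2 ≤ s) (h : ∑ a, m a * t a ^ s ≤ N * τ ^ s) : ∑ a, m a * t a ^ 2 ≤ N * τ ^ 2 := by
  have hpow : ∀ u : ℝ, 0 ≤ u → (u ^ 2) ^ (s / 2) = u ^ s := by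
    intro u hu
    rw [← Real.rpow_natCast, ← Real.rpow_mul hu]
    congr 1
    push_cast
    ring
  have hw : ∑ a, m a / N = 1 := by rw [← Finset.sum_div, hmN, div_self hN.ne']
  have key := Real.rpow_arith_mean_le_arith_mean_rpow Finset.univ (fun a => m a / N)
    (fun a => t a ^ 2) (fun a _ => div_nonneg (hm a) hN.le) hw (fun a _ => sq_nonneg _)
    (by linarith : 1 ≤ s / 2)
  simp only [hpow _ (ht _)] at key
  have e1 : ∑ a, m a / N * t a ^ s = (∑ a, m a * t a ^ s) / N := by
    rw [Finset.sum_div]; exact Finset.sum_congr rfl fun a _ => by ring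
  have e2 : ∑ a, m a / N * t a ^ 2 = (∑ a, m a * t a ^ 2) / N := by
    rw [Finset.sum_div]; exact Finset.sum_congr rfl fun a _ => by ring
  rw [e1, e2] at key
  have h3 : (∑ a, m a * t a ^ s) / N ≤ (τ ^ 2) ^ (s / 2) := by
    rw [hpow τ hτ, div_le_iff₀ hN]; linarith
  have h4 := (Real.rpow_le_rpow_iff (div_nonneg (Finset.sum_nonneg fun a _ =>
    mul_nonneg (hm a) (sq_nonneg _)) hN.le) (sq_nonneg τ) (by linarith : 0 < s / 2)).1
    (key.trans h3)
  rw [div_le_iff₀ hN] at h4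
  linarith

/-- Stability of the simplex as an extremal body: a quantitative version for a symmetric body `L`
whose polar satisfies a power-type modulus of convexity. -/
theorem banachMazurDist_simplex_le_of_modulus {n : ℕ} (hE : Module.finrank ℝ E = n) (hn : 2 ≤ n)
    {L : Set E} (hL : IsConvexBody L) (hL0 : (0 : E) ∈ interior L) (hLs : ∀ x ∈ L, -x ∈ L)
    (hLn : ∀ x ∈ L, ‖x‖ ≤ √n) (hPn : ∀ y ∈ innerPolar L, ‖y‖ ≤ √n)
    {ω s τ ε : ℝ} (hω : 0 < ω) (hs : 2 ≤ s) (hτ0 : 0 ≤ τ) (hτ : 128 * (n : ℝ) ^ 5 * τ ≤ 1)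
    (hε : ε = ω * τ ^ s) (hε1 : 1 < (1 - ε) * n)
    (hmod : ∀ x ∈ L, ∀ Y ∈ innerPolar L, ∀ y ∈ innerPolar L, inner ℝ Y x = 1 →
      ω * ‖y - Y‖ ^ s ≤ 1 - inner ℝ y x)
    (S : Affine.Simplex ℝ E n) {K : Set E} (hK : IsConvexBody K)
    (hd : (1 - ε) * n ≤ banachMazurDist K L) :
    banachMazurDist K (convexHull ℝ (Set.range S.points)) ≤ 1 + 1536 * (n : ℝ) ^ 6 * τ ^ 2 := by
  classical
  have : Nontrivial E := Module.nontrivial_of_finrank_pos (R := ℝ) (by omega)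
  have hn2 : (2 : ℝ) ≤ n := by exact_mod_cast hn
  have hn0 : (0 : ℝ) < n := by linarith
  have hLne : L.Nonempty := ⟨0, interior_subset hL0⟩
  obtain ⟨T, v, hTL, hmax⟩ :=
    exists_position_det_le_one hL.isCompact hL0 hK.isCompact hK.interior_nonempty
  set K' := (fun x => T x + v) '' K with hK'
  have hK'b : IsConvexBody K' := hK.image_affine T v
  have hK'L : K' ⊆ L := by rintro _ ⟨x, hx, rfl⟩; exact hTL x hx
  obtain ⟨ι, _, c, x, y, hc0, hxK, hyP, hdec, hcy, hcs⟩ := exists_john_decomposition hL.isCompact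
    hL.convex hL0 hK'b.isCompact hK'L
    (fun T' v' h => hmax T' v' fun x hx => h _ ⟨x, hx, rfl⟩)
  obtain ⟨m, f, hm0, hm, hf0, hfs, hfr⟩ :=
    exists_obstruction_of_le_banachMazurDist hK hL.isCompact hLne hε1 hd T v hTL
  set H := ∑ j, supportFun K' (f j) with hH
  have hHpos : 0 < H := by
    obtain ⟨k, hk⟩ := hK'b.interior_nonempty
    have : ∑ j, inner ℝ (f j) k < H :=
      Finset.sum_lt_sum_of_nonempty ⟨⟨0, hm0⟩, Finset.mem_univ _⟩
        fun j _ => inner_lt_supportFun hK'b.isCompact (hf0 j) hk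
    rwa [← sum_inner, hfs, inner_zero_left] at this
  -- This scaling makes the support numbers of `K'` sum to one.
  set g : Fin m → E := fun j => H⁻¹ • f j with hg
  have hg0 : ∀ j, g j ≠ 0 := fun j => smul_ne_zero (inv_pos.2 hHpos).ne' (hf0 j)
  have hgs : ∑ j, g j = 0 := by rw [hg, ← Finset.smul_sum, hfs, smul_zero]
  set h : Fin m → ℝ := fun j => supportFun K' (g j) with hh
  have hK'ne : K'.Nonempty := hK'b.interior_nonempty.mono interior_subset
  have hhs : ∑ j, h j = 1 := by
    simp only [hh, hg, supportFun_smul hK'b.isCompact hK'ne (inv_pos.2 hHpos).le, ← Finset.mul_sum]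
    exact inv_mul_cancel₀ hHpos.ne'
  have hgL : (1 - ε) * n ≤ ∑ j, supportFun L (g j) := by
    simp only [hg, supportFun_smul hL.isCompact hLne (inv_pos.2 hHpos).le, ← Finset.mul_sum]
    rw [le_inv_mul_iff₀ hHpos]
    linarith
  choose ξ hξL hξ using fun j => exists_inner_eq_supportFun hL.isCompact hLne (g j)
  have hpos : ∀ j, 0 < supportFun L (g j) := fun j => supportFun_pos hL.isCompact hL0 (hg0 j)
  -- The normalized functional that norms `-ξ j`; the sign matches the defect `1 + ⟪y i, ξ j⟫`, and
  -- symmetry of `L` puts it in the polar.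
  set Y : Fin m → E := fun j => -((supportFun L (g j))⁻¹ • g j) with hY
  have hYP : ∀ j, Y j ∈ innerPolar L := by
    intro j z hz
    rw [hY, inner_neg_left, ← inner_neg_right, real_inner_smul_left, inv_mul_le_iff₀ (hpos j),
      mul_one]
    exact inner_le_supportFun hL.isCompact _ (hLs z hz)
  have hYξ : ∀ j, inner ℝ (Y j) (-ξ j) = 1 := by
    intro j
    rw [hY, inner_neg_left, inner_neg_right, neg_neg, real_inner_smul_left, hξ,
      inv_mul_cancel₀ (hpos j).ne']
  set b : ι → Fin m → ℝ := fun i j => h j - inner ℝ (g j) (x i) with hb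
  have hb0K : ∀ z ∈ K', ∀ j, 0 ≤ h j - inner ℝ (g j) z := fun z hz j =>
    sub_nonneg.2 (inner_le_supportFun hK'b.isCompact _ hz)
  have hbs : ∀ z, ∑ j, (h j - inner ℝ (g j) z) = 1 := by
    intro z
    rw [Finset.sum_sub_distrib, hhs, ← sum_inner, hgs, inner_zero_left, sub_zero]
  have hρ2 : √(n : ℝ) ^ 2 = n := Real.sq_sqrt hn0.le
  have hρ3 : √(n : ℝ) ^ 3 ≤ (n : ℝ) ^ 2 := by
    have h1 : √(n : ℝ) ≤ n := by
      rw [Real.sqrt_le_left hn0.le]; nlinarith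
    calc √(n : ℝ) ^ 3 = √(n : ℝ) ^ 2 * √(n : ℝ) := by ring
      _ ≤ (n : ℝ) * n := by rw [hρ2]; exact mul_le_mul_of_nonneg_left h1 hn0.le
      _ = _ := by ring
  have hn25 : (n : ℝ) ^ 2 ≤ (n : ℝ) ^ 5 := pow_le_pow_right₀ (by linarith) (by norm_num)
  have hcs' : ∑ i, c i = n := by rw [hcs, hE]
  have hmass : ∑ q : ι × Fin m, c q.1 * b q.1 q.2 = n := by
    rw [Fintype.sum_prod_type]
    simp only [← Finset.mul_sum, hb, hbs, mul_one, hcs']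
  have hmass0 : ∀ q : ι × Fin m, 0 ≤ c q.1 * b q.1 q.2 := fun q =>
    mul_nonneg (hc0 _) (hb0K _ (hxK _) _)
  have hdist : ∑ i, ∑ j, c i * b i j * ‖y i - Y j‖ ^ 2 ≤ √(n : ℝ) ^ 2 * τ ^ 2 := by
    have h1 := sum_defect_le (ε := ε) hdec hcy hcs' hgs hhs
      (hgL.trans_eq (Finset.sum_congr rfl fun j _ => (hξ j).symm))
    have h2 := sum_mul_sq_le_of_sum_mul_rpow_le (t := fun q : ι × Fin m => ‖y q.1 - Y q.2‖)
      hn0 hmass0 hmass (fun q => norm_nonneg _) hτ0 hs ?_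
    · rw [Fintype.sum_prod_type] at h2
      rw [hρ2]; exact h2
    · refine le_of_mul_le_mul_left ?_ hω
      rw [Fintype.sum_prod_type]
      calc ω * ∑ i, ∑ j, c i * b i j * ‖y i - Y j‖ ^ s
          ≤ ∑ i, ∑ j, c i * b i j * (1 + inner ℝ (y i) (ξ j)) := by
            rw [Finset.mul_sum]
            refine Finset.sum_le_sum fun i _ => ?_
            rw [Finset.mul_sum]
            refine Finset.sum_le_sum fun j _ => ?_
            have h3 : ω * ‖y i - Y j‖ ^ s ≤ 1 + inner ℝ (y i) (ξ j) := by
              have h4 := hmod _ (hLs _ (hξL j)) _ (hYP j) _ (hyP i) (hYξ j)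
              have h5 : inner ℝ (y i) (-ξ j) = -inner ℝ (y i) (ξ j) := inner_neg_right _ _
              linarith
            rw [mul_left_comm]
            exact mul_le_mul_of_nonneg_left h3 (hmass0 (i, j))
        _ ≤ ε * n := h1
        _ = ω * (n * τ ^ s) := by rw [hε]; ring
  have hdecomp : IsApproxDecomposition √(n : ℝ) τ c x y b Y :=
    { rho_pos := Real.sqrt_pos.2 hn0
      rho_sq := by rw [hρ2, hE]
      tau_nonneg := hτ0
      tau_le := by
        have : √(n : ℝ) ^ 3 * τ ≤ (n : ℝ) ^ 5 * τ :=
          mul_le_mul_of_nonneg_right (hρ3.trans hn25) hτ0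
        have : 0 ≤ (n : ℝ) ^ 5 * τ := by positivity
        linarith
      c_nonneg := hc0
      c_sum := by rw [hρ2, hcs']
      x_norm := fun i => hLn _ (hK'L (hxK i))
      Y_norm := fun j => hPn _ (hYP j)
      decomp := hdec
      c_smul_y := hcy
      b_nonneg := fun i j => hb0K _ (hxK i) j
      b_sum := fun i => hbs _
      dist_sq := hdist }
  have hcard : Fintype.card (Fin m) ≤ Module.finrank ℝ E + 1 := by simpa using hm
  have hmn : m = n + 1 := by have := hdecomp.card_eq hcard; simpa [hE] using this
  subst hmn
  set B : Fin (n + 1) → ℝ := fun j => ∑ i, c i * b i j with hB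
  have hB1 : ∀ j, 1 ≤ 8 * n * B j := fun j => by
    have := hdecomp.one_le_mass hcard j
    rwa [hρ2] at this
  have hBpos : ∀ j, 0 < B j := fun j => by
    by_contra hcon
    have := hB1 j
    nlinarith [not_lt.1 hcon]
  -- Near-vertices: the average of the `x i` with weights `c i b i j`. As the coordinates are
  -- affine, the missing part of coordinate `j`, times `B j`, is exactly `∑ c i b i j (1 - b i j)`.
  have hX : ∀ j, ∑ i, (c i * b i j / B j) • x i ∈ K' := fun j =>
    hK'b.convex.sum_mem (fun i _ => div_nonneg (hmass0 (i, j)) (hBpos j).le)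
      (by rw [← Finset.sum_div]; exact div_self (hBpos j).ne') fun i _ => hxK i
  choose X hXK hXe using hX
  -- Here `512 n ^ 5 = 8 n · 64 n ^ 4` combines the mass bound with `64 ρ ^ 8`, and `n + 1 ≤ 3 n /
  -- 2` gives 768.
  have hsmall : (n + 1 : ℝ) * (512 * (n : ℝ) ^ 5 * τ ^ 2) ≤ 768 * (n : ℝ) ^ 6 * τ ^ 2 := by
    have : (0 : ℝ) ≤ (n : ℝ) ^ 5 * τ ^ 2 := by positivity
    nlinarith
  have hhalf : 768 * (n : ℝ) ^ 6 * τ ^ 2 ≤ 1 / 2 := by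
    have h1 : (128 * (n : ℝ) ^ 5 * τ) ^ 2 ≤ 1 := pow_le_one₀ (by positivity) hτ
    have h2 : (n : ℝ) ^ 6 * τ ^ 2 ≤ (n : ℝ) ^ 10 * τ ^ 2 :=
      mul_le_mul_of_nonneg_right (pow_le_pow_right₀ (by linarith) (by norm_num)) (sq_nonneg τ)
    nlinarith
  refine (banachMazurDist_simplex_le hE S hK.convex T v g h hgs hhs
    (κ := 512 * (n : ℝ) ^ 5 * τ ^ 2) (by positivity) (hsmall.trans hhalf)
    (fun x hx j => hb0K _ ⟨x, hx, rfl⟩ j) X hXK fun j => ?_).trans (by linarith)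
  have h1 := hdecomp.sum_mass_mul_one_sub_le hcard j
  have h8 : √(n : ℝ) ^ 8 = (n : ℝ) ^ 4 := by
    rw [show (8 : ℕ) = 2 * 4 by norm_num, pow_mul, hρ2]
  rw [h8] at h1
  have h2 : B j * (1 - (h j - inner ℝ (g j) (T (X j) + v))) = ∑ i, c i * b i j * (1 - b i j) := by
    have h3 : T (X j) + v = ∑ i, (c i * b i j / B j) • x i := hXe j
    rw [h3, inner_sum]
    simp only [inner_smul_right]
    have h4 : B j * ∑ i, c i * b i j / B j * inner ℝ (g j) (x i)
        = ∑ i, c i * b i j * inner ℝ (g j) (x i) := by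
      rw [Finset.mul_sum]
      refine Finset.sum_congr rfl fun i _ => ?_
      rw [← mul_assoc, mul_div_cancel₀ _ (hBpos j).ne']
    have h5 : ∑ i, c i * b i j * (1 - b i j)
        = (∑ i, c i * b i j) * (1 - h j) + ∑ i, c i * b i j * inner ℝ (g j) (x i) := by
      rw [Finset.sum_mul, ← Finset.sum_add_distrib]
      refine Finset.sum_congr rfl fun i _ => ?_
      simp only [hb]; ring
    rw [h5, ← h4]
    simp only [hB]; ring
  rw [← h2] at h1
  generalize 1 - (h j - inner ℝ (g j) (T (X j) + v)) = u at h1 ⊢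
  rcases le_or_gt u 0 with hu | hu
  · exact hu.trans (by positivity)
  · calc u = 1 * u := (one_mul u).symm
      _ ≤ 8 * n * B j * u := mul_le_mul_of_nonneg_right (hB1 j) hu.le
      _ = 8 * n * (B j * u) := by ring
      _ ≤ 8 * n * (64 * (n : ℝ) ^ 4 * τ ^ 2) := mul_le_mul_of_nonneg_left h1 (by positivity)
      _ = _ := by ring

end Stability

/-! ### Scalar defects in Young's inequality -/

section ScalarModulus

/-- A differentiable function with monotone derivative lies above its tangents. -/
theorem tangent_le_of_monotoneOn_deriv {G g : ℝ → ℝ} {a b : ℝ}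
    (hG : ContinuousOn G (Set.Icc a b)) (hd : ∀ s ∈ Set.Ioo a b, HasDerivAt G (g s) s)
    (hg : MonotoneOn g (Set.Icc a b)) {y Y : ℝ} (hy : y ∈ Set.Icc a b) (hY : Y ∈ Set.Icc a b) :
    G Y + g Y * (y - Y) ≤ G y := by
  rcases lt_trichotomy y Y with h | rfl | h
  · obtain ⟨c, hc, hce⟩ := exists_hasDerivAt_eq_slope G g h
      (hG.mono (Set.Icc_subset_Icc hy.1 hY.2))
      fun s hs => hd s ⟨hy.1.trans_lt hs.1, hs.2.trans_le hY.2⟩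
    have h1 : g c ≤ g Y := hg ⟨hy.1.trans hc.1.le, hc.2.le.trans hY.2⟩ hY hc.2.le
    rw [eq_div_iff (by linarith)] at hce
    nlinarith
  · simp
  · obtain ⟨c, hc, hce⟩ := exists_hasDerivAt_eq_slope G g h
      (hG.mono (Set.Icc_subset_Icc hY.1 hy.2))
      fun s hs => hd s ⟨hY.1.trans_lt hs.1, hs.2.trans_le hy.2⟩
    have h1 : g Y ≤ g c := hg hY ⟨hY.1.trans hc.1.le, hc.2.le.trans hy.2⟩ hc.1.le
    rw [eq_div_iff (by linarith)] at hce
    nlinarith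

/-- Strong convexity of `|s| ^ q / q` on `[-1, 1]` for `1 < q ≤ 2`. -/
theorem rpow_bregman_ge_sq {q Y y : ℝ} (hq : 1 < q) (hq2 : q ≤ 2) (hY0 : 0 ≤ Y) (hY1 : Y ≤ 1)
    (hy : |y| ≤ 1) :
    (q - 1) / 2 * (y - Y) ^ 2 ≤ |y| ^ q / q - Y ^ q / q - Y ^ (q - 1) * (y - Y) := by
  have hq0 : 0 < q := by linarith
  rcases le_or_gt 0 y with hy0 | hy0
  · rw [abs_of_nonneg hy0] at hy ⊢
    -- Subtracting `(q - 1) / 2 * s ^ 2` preserves convexity on `[0, 1]`, since `s ^ (q - 2) ≥ 1`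
    -- there.
    have key := tangent_le_of_monotoneOn_deriv (a := 0) (b := 1)
      (G := fun s => s ^ q / q - (q - 1) / 2 * s ^ 2) (g := fun s => s ^ (q - 1) - (q - 1) * s)
      (by
        refine ContinuousOn.sub (ContinuousOn.div_const ?_ _) (by fun_prop)
        exact (Real.continuous_rpow_const hq0.le).continuousOn)
      (fun s hs => by
        have h1 := (Real.hasDerivAt_rpow_const (x := s) (p := q) (Or.inl hs.1.ne')).div_const q
        have h2 := (hasDerivAt_pow 2 s).const_mul ((q - 1) / 2)
        convert! h1.sub h2 using 1
        field_simp
        push_cast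
        ring)
      (by
        refine monotoneOn_of_deriv_nonneg (convex_Icc 0 1) ?_ ?_ ?_
        · refine ContinuousOn.sub ?_ (by fun_prop)
          exact (Real.continuous_rpow_const (by linarith)).continuousOn
        · intro s hs
          rw [interior_Icc] at hs
          exact ((Real.hasDerivAt_rpow_const (Or.inl hs.1.ne')).sub
            ((hasDerivAt_id s).const_mul (q - 1))).differentiableAt.differentiableWithinAt
        · intro s hs
          rw [interior_Icc] at hs
          have h1 : HasDerivAt (fun s => s ^ (q - 1) - (q - 1) * s)
              ((q - 1) * s ^ (q - 1 - 1) - (q - 1) * 1) s :=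
            (Real.hasDerivAt_rpow_const (Or.inl hs.1.ne')).sub ((hasDerivAt_id s).const_mul (q - 1))
          rw [h1.deriv]
          have h2 : 1 ≤ s ^ (q - 1 - 1) :=
            Real.one_le_rpow_of_pos_of_le_one_of_nonpos hs.1 hs.2.le (by linarith)
          nlinarith)
      (⟨hy0, hy⟩ : y ∈ Set.Icc (0 : ℝ) 1) (⟨hY0, hY1⟩ : Y ∈ Set.Icc (0 : ℝ) 1)
    nlinarith
  · rw [abs_of_neg hy0] at hy ⊢
    -- Across the origin, `(y - Y) ^ 2 = z ^ 2 + 2 z Y + Y ^ 2` and the three terms are bounded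
    -- separately.
    set z := -y
    have hyz : y = -z := by simp [z]
    have hz0 : 0 < z := by simp only [z]; linarith
    rw [hyz]
    have h1 : z ^ 2 ≤ z ^ q := by
      rw [← Real.rpow_natCast]
      exact Real.rpow_le_rpow_of_exponent_ge hz0 hy (by exact_mod_cast hq2)
    rcases hY0.eq_or_lt with rfl | hYp
    · rw [Real.zero_rpow hq0.ne', Real.zero_rpow (by linarith)]
      have h2 : (q - 1) / 2 * z ^ 2 ≤ z ^ q / q := by
        rw [le_div_iff₀ hq0]
        have h3 : (q - 1) / 2 * q ≤ 1 := by nlinarith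
        have h4 : (q - 1) / 2 * q * z ^ 2 ≤ 1 * z ^ 2 :=
          mul_le_mul_of_nonneg_right h3 (sq_nonneg z)
        linarith
      simpa using h2
    have h2 : Y ^ 2 ≤ Y ^ q := by
      rw [← Real.rpow_natCast]
      exact Real.rpow_le_rpow_of_exponent_ge hYp hY1 (by exact_mod_cast hq2)
    have h3 : Y ≤ Y ^ (q - 1) := by
      conv_lhs => rw [← Real.rpow_one Y]
      exact Real.rpow_le_rpow_of_exponent_ge hYp hY1 (by linarith)
    have h4 : Y ^ (q - 1) * Y = Y ^ q := by
      rw [← Real.rpow_add_one hYp.ne']; congr 1; ring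
    have e1 : (q - 1) / 2 * z ^ 2 ≤ z ^ q / q := by
      rw [le_div_iff₀ hq0]
      have h3 : (q - 1) / 2 * q ≤ 1 := by nlinarith
      have h4 : (q - 1) / 2 * q * z ^ 2 ≤ 1 * z ^ 2 := mul_le_mul_of_nonneg_right h3 (sq_nonneg z)
      linarith
    have e2 : (q - 1) / 2 * Y ^ 2 ≤ Y ^ q - Y ^ q / q := by
      have : Y ^ q - Y ^ q / q = (q - 1) / q * Y ^ q := by field_simp
      rw [this]
      have h5 : (q - 1) / 2 ≤ (q - 1) / q := by
        apply div_le_div_of_nonneg_left <;> linarith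
      exact mul_le_mul h5 h2 (sq_nonneg _) (by
        apply div_nonneg <;> linarith)
    have e3 : (q - 1) * (Y * z) ≤ Y ^ (q - 1) * z := by
      have := mul_le_mul_of_nonneg_right h3 hz0.le
      have : 0 ≤ Y * z := by positivity
      nlinarith
    nlinarith

/-- The scalar Clarkson inequality for exponents at least two. -/
theorem two_mul_abs_rpow_add_le {q : ℝ} (hq : 2 ≤ q) (u v : ℝ) :
    2 * (|u| ^ q + |v| ^ q) ≤ |u + v| ^ q + |u - v| ^ q := by
  have hpow : ∀ t : ℝ, |t| ^ q = (t ^ 2) ^ (q / 2) := by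
    intro t
    rw [← sq_abs, ← Real.rpow_natCast, ← Real.rpow_mul (abs_nonneg t)]
    congr 1
    push_cast
    ring
  have hr : 1 ≤ q / 2 := by linarith
  have h1 : (u ^ 2) ^ (q / 2) + (v ^ 2) ^ (q / 2) ≤ (u ^ 2 + v ^ 2) ^ (q / 2) :=
    Real.add_rpow_le_rpow_add (sq_nonneg _) (sq_nonneg _) hr
  have h2 := (convexOn_rpow hr).2 (Set.mem_Ici.2 (sq_nonneg (u + v)))
    (Set.mem_Ici.2 (sq_nonneg (u - v))) (by norm_num : (0 : ℝ) ≤ 1 / 2)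
    (by norm_num : (0 : ℝ) ≤ 1 / 2) (by norm_num)
  simp only [smul_eq_mul] at h2
  have h3 : 1 / 2 * (u + v) ^ 2 + 1 / 2 * (u - v) ^ 2 = u ^ 2 + v ^ 2 := by ring
  rw [h3] at h2
  simp only [hpow]
  linarith

/-- The power of the coordinate of a vector that appears in its norming functional. -/
noncomputable def signedRpow (a r : ℝ) : ℝ := if 0 ≤ a then a ^ r else -(-a) ^ r

theorem signedRpow_neg {r : ℝ} (hr : r ≠ 0) (a : ℝ) : signedRpow (-a) r = -signedRpow a r := by
  rcases lt_trichotomy a 0 with h | rfl | h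
  · simp [signedRpow, h.le, not_le.2 h]
  · simp [signedRpow, Real.zero_rpow hr]
  · simp [signedRpow, h.le, not_le.2 h]

/-- The defect in Young's inequality as a Bregman distance. -/
theorem young_defect_eq {p q a : ℝ} (hpq : p.HolderConjugate q) (ha : 0 ≤ a) (y : ℝ) :
    a ^ p / p + |y| ^ q / q - a * y = |y| ^ q / q - (a ^ (p - 1)) ^ q / q
      - (a ^ (p - 1)) ^ (q - 1) * (y - a ^ (p - 1)) := by
  have h1 : (p - 1) * (q - 1) = 1 := by
    have := hpq.sub_one_mul_conj
    nlinarith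
  have h2 : (a ^ (p - 1)) ^ (q - 1) = a := by rw [← Real.rpow_mul ha, h1, Real.rpow_one]
  have h3 : (a ^ (p - 1)) ^ q = a ^ p := by
    rw [← Real.rpow_mul ha, hpq.sub_one_mul_conj]
  have h4 : a * a ^ (p - 1) = a ^ p := by
    rcases ha.eq_or_lt with rfl | ha
    · rw [Real.zero_rpow hpq.pos.ne', zero_mul]
    · rw [mul_comm, ← Real.rpow_add_one ha.ne']; congr 1; ring
  have h5 : p⁻¹ = 1 - q⁻¹ := by linarith [hpq.inv_add_inv_eq_one]
  rw [h2, h3, mul_sub, h4, div_eq_mul_inv (a ^ p) p, h5]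
  ring

/-- Oddness of the signed power reduces to `a ≥ 0`, where the defect is the Bregman distance of `y`
from `a ^ (p - 1)`. -/
theorem young_defect_ge_of_nonneg {Φ : ℝ → ℝ} {p q : ℝ} (hpq : p.HolderConjugate q)
    (hΦ : ∀ Y y : ℝ, 0 ≤ Y → Y ≤ 1 → |y| ≤ 1 →
      Φ |y - Y| ≤ |y| ^ q / q - Y ^ q / q - Y ^ (q - 1) * (y - Y))
    {a y : ℝ} (ha : |a| ≤ 1) (hy : |y| ≤ 1) :
    Φ |y - signedRpow a (p - 1)| ≤ |a| ^ p / p + |y| ^ q / q - a * y := by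
  have hp1 : 0 < p - 1 := hpq.sub_one_pos
  have main : ∀ a y : ℝ, 0 ≤ a → a ≤ 1 → |y| ≤ 1 →
      Φ |y - signedRpow a (p - 1)| ≤ |a| ^ p / p + |y| ^ q / q - a * y := by
    intro a y ha ha1 hy
    rw [abs_of_nonneg ha, young_defect_eq hpq ha, signedRpow, if_pos ha]
    exact hΦ _ y (Real.rpow_nonneg ha _) (Real.rpow_le_one ha ha1 hp1.le) hy
  rcases le_total 0 a with h | h
  · exact main a y h (by rwa [abs_of_nonneg h] at ha) hy
  · have := main (-a) (-y) (by linarith) (by rwa [abs_of_nonpos h] at ha) (by rwa [abs_neg])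
    rw [signedRpow_neg hp1.ne', abs_neg, abs_neg, neg_mul_neg] at this
    have e : |-y - -signedRpow a (p - 1)| = |y - signedRpow a (p - 1)| := by
      rw [neg_sub_neg, abs_sub_comm]
    rwa [e] at this

/-- Clarkson's inequality at `(y ± Y) / 2` produces the gain and leaves the midpoint value, which
Young's inequality bounds below by the tangent at `Y`. -/
theorem rpow_bregman_ge_rpow {q Y y : ℝ} (hq : 2 ≤ q) (hY0 : 0 ≤ Y) :
    2 / q * (|y - Y| / 2) ^ q ≤ |y| ^ q / q - Y ^ q / q - Y ^ (q - 1) * (y - Y) := by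
  have hq0 : 0 < q := by linarith
  have h1 := two_mul_abs_rpow_add_le hq ((y + Y) / 2) ((y - Y) / 2)
  rw [show (y + Y) / 2 + (y - Y) / 2 = y by ring, show (y + Y) / 2 - (y - Y) / 2 = Y by ring,
    abs_of_nonneg hY0, abs_div (y - Y), abs_two] at h1
  have hpq : (q / (q - 1)).HolderConjugate q :=
    (Real.HolderConjugate.conjExponent (by linarith : 1 < q)).symm
  set a := Y ^ (q - 1) with ha
  have h2 := Real.young_inequality a ((y + Y) / 2) hpq
  have ha0 : 0 ≤ a := Real.rpow_nonneg hY0 _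
  have h3 : a ^ (q / (q - 1)) = Y ^ q := by
    rw [ha, ← Real.rpow_mul hY0, mul_div_cancel₀ _ (by linarith : q - 1 ≠ 0)]
  have h4 : a * Y = Y ^ q := by
    rcases hY0.eq_or_lt with h | h
    · rw [← h, mul_zero, Real.zero_rpow hq0.ne']
    · rw [ha, ← Real.rpow_add_one h.ne']; congr 1; ring
  rw [abs_of_nonneg ha0, h3] at h2
  have h5 : Y ^ q / (q / (q - 1)) = Y ^ q - Y ^ q / q := by field_simp
  rw [h5] at h2
  have h6 := div_le_div_of_nonneg_right h1 hq0.le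
  have h7 : 2 * (|(y + Y) / 2| ^ q + (|y - Y| / 2) ^ q) / q
      = 2 * (|(y + Y) / 2| ^ q / q) + 2 / q * (|y - Y| / 2) ^ q := by ring
  rw [h7, add_div (|y| ^ q)] at h6
  generalize |(y + Y) / 2| ^ q = U at h2 h6
  have h8 : a * ((y + Y) / 2) = (a * y + a * Y) / 2 := by ring
  rw [h8] at h2
  rw [mul_sub]
  linarith

end ScalarModulus

/-! ### The `ℓ_p` ball and the modulus of its polar -/

section LpBall

variable {n : ℕ} {p q : ℝ}

theorem abs_apply_le_one_of_mem_lpUnitBall (hp : 0 < p) {x : EuclideanSpace ℝ (Fin n)}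
    (hx : x ∈ lpUnitBall p n) (i : Fin n) : |x i| ≤ 1 := by
  have h1 : |x i| ^ p ≤ 1 := le_trans (Finset.single_le_sum (f := fun i => |x i| ^ p)
    (fun i _ => Real.rpow_nonneg (abs_nonneg _) _) (Finset.mem_univ i)) hx
  by_contra h
  exact absurd h1 (not_le.2 (Real.one_lt_rpow (not_le.1 h) hp))

theorem norm_le_sqrt_of_forall_abs_le_one {x : EuclideanSpace ℝ (Fin n)} (hx : ∀ i, |x i| ≤ 1) :
    ‖x‖ ≤ √n := by
  rw [EuclideanSpace.norm_eq]
  apply Real.sqrt_le_sqrt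
  calc ∑ i, ‖x i‖ ^ 2 ≤ ∑ _i : Fin n, (1 : ℝ) :=
        Finset.sum_le_sum fun i _ => pow_le_one₀ (norm_nonneg _) (hx i)
    _ = n := by simp

theorem continuous_sum_abs_rpow (hp : 0 ≤ p) :
    Continuous fun x : EuclideanSpace ℝ (Fin n) => ∑ i, |x i| ^ p := by
  refine continuous_finsetSum _ fun i _ => ?_
  exact (Real.continuous_rpow_const hp).comp (by fun_prop)

theorem zero_mem_interior_lpUnitBall (hp : 0 < p) :
    (0 : EuclideanSpace ℝ (Fin n)) ∈ interior (lpUnitBall p n) := by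
  rw [mem_interior]
  refine ⟨{x | ∑ i, |x i| ^ p < 1}, fun x (hx : ∑ i, |x i| ^ p < 1) =>
    show ∑ i, |x i| ^ p ≤ 1 from hx.le,
    isOpen_lt (continuous_sum_abs_rpow hp.le) continuous_const, ?_⟩
  simp [Real.zero_rpow hp.ne']

theorem isConvexBody_lpUnitBall (hp : 1 ≤ p) : IsConvexBody (lpUnitBall p n) := by
  have hp0 : 0 < p := by linarith
  refine ⟨?_, ?_, ⟨0, zero_mem_interior_lpUnitBall hp0⟩⟩
  · apply Metric.isCompact_of_isClosed_isBounded
    · exact isClosed_le (continuous_sum_abs_rpow hp0.le) continuous_const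
    · refine (Metric.isBounded_iff_subset_closedBall 0).2 ⟨√n, fun x hx => ?_⟩
      rw [mem_closedBall_zero_iff]
      exact norm_le_sqrt_of_forall_abs_le_one (abs_apply_le_one_of_mem_lpUnitBall hp0 hx)
  · intro x hx y hy a b ha hb hab
    have key : ∀ i, |(a • x + b • y) i| ^ p ≤ a * |x i| ^ p + b * |y i| ^ p := by
      intro i
      have h1 : |(a • x + b • y) i| ≤ a * |x i| + b * |y i| := by
        simp only [PiLp.add_apply, PiLp.smul_apply, smul_eq_mul]
        refine (abs_add_le _ _).trans_eq ?_
        rw [abs_mul, abs_mul, abs_of_nonneg ha, abs_of_nonneg hb]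
      have h2 := (convexOn_rpow hp).2 (Set.mem_Ici.2 (abs_nonneg (x i)))
        (Set.mem_Ici.2 (abs_nonneg (y i))) ha hb hab
      exact (Real.rpow_le_rpow (abs_nonneg _) h1 hp0.le).trans h2
    calc ∑ i, |(a • x + b • y) i| ^ p ≤ ∑ i, (a * |x i| ^ p + b * |y i| ^ p) :=
          Finset.sum_le_sum fun i _ => key i
      _ = a * ∑ i, |x i| ^ p + b * ∑ i, |y i| ^ p := by
          rw [Finset.sum_add_distrib, Finset.mul_sum, Finset.mul_sum]
      _ ≤ a * 1 + b * 1 :=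
          add_le_add (mul_le_mul_of_nonneg_left hx ha) (mul_le_mul_of_nonneg_left hy hb)
      _ = 1 := by linarith

theorem neg_mem_lpUnitBall {x : EuclideanSpace ℝ (Fin n)} (hx : x ∈ lpUnitBall p n) :
    -x ∈ lpUnitBall p n := by
  simpa [lpUnitBall] using hx

theorem abs_apply_le_one_of_mem_innerPolar (hp : 0 < p) {y : EuclideanSpace ℝ (Fin n)}
    (hy : y ∈ innerPolar (lpUnitBall p n)) (i : Fin n) : |y i| ≤ 1 := by
  have hmem : EuclideanSpace.single i (1 : ℝ) ∈ lpUnitBall p n := by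
    change ∑ k, |EuclideanSpace.single i (1 : ℝ) k| ^ p ≤ 1
    rw [Finset.sum_eq_single i]
    · simp
    · intro k _ hk; simp [hk, Real.zero_rpow hp.ne']
    · simp
  have h1 := hy _ hmem
  have h2 := hy _ (neg_mem_lpUnitBall hmem)
  simp only [inner_neg_right, EuclideanSpace.inner_single_right] at h1 h2
  simp at h1 h2
  exact abs_le.2 ⟨by linarith, h1⟩

/-- Test with the equality case of Hölder: the normalized signed power `x` of `y` lies in the ball
and `⟪y, x⟫ = N ^ (1 / q)`. -/
theorem sum_abs_rpow_le_one_of_mem_innerPolar (hpq : p.HolderConjugate q)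
    {y : EuclideanSpace ℝ (Fin n)} (hy : y ∈ innerPolar (lpUnitBall p n)) :
    ∑ i, |y i| ^ q ≤ 1 := by
  set N := ∑ i, |y i| ^ q with hN
  have hN0 : 0 ≤ N := Finset.sum_nonneg fun i _ => Real.rpow_nonneg (abs_nonneg _) _
  rcases hN0.eq_or_lt with h0 | hpos
  · rw [← h0]; exact zero_le_one
  have hq1 : q - 1 ≠ 0 := hpq.symm.sub_one_pos.ne'
  set x : EuclideanSpace ℝ (Fin n) :=
    WithLp.toLp 2 fun i => N ^ (-p⁻¹) * signedRpow (y i) (q - 1) with hx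
  have habs : ∀ a : ℝ, |signedRpow a (q - 1)| = |a| ^ (q - 1) := by
    intro a
    unfold signedRpow
    split_ifs with h
    · rw [abs_of_nonneg h, abs_of_nonneg (Real.rpow_nonneg h _)]
    · have h' : 0 ≤ -a := by linarith
      rw [abs_neg, abs_of_nonneg (Real.rpow_nonneg h' _), abs_of_nonpos (by linarith : a ≤ 0)]
  have hmul : ∀ a : ℝ, a * signedRpow a (q - 1) = |a| ^ q := by
    intro a
    have key : ∀ a : ℝ, 0 ≤ a → a * a ^ (q - 1) = a ^ q := by
      intro a ha
      rcases ha.eq_or_lt with rfl | ha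
      · rw [zero_mul, Real.zero_rpow hpq.symm.pos.ne']
      · rw [mul_comm, ← Real.rpow_add_one ha.ne']; congr 1; ring
    unfold signedRpow
    split_ifs with h
    · rw [abs_of_nonneg h, key a h]
    · have h' : 0 ≤ -a := by linarith
      rw [abs_of_nonpos (by linarith : a ≤ 0), ← key _ h']; ring
  have hxL : x ∈ lpUnitBall p n := by
    change ∑ i, |x i| ^ p ≤ 1
    have : ∀ i, |x i| ^ p = N⁻¹ * |y i| ^ q := by
      intro i
      simp only [hx]
      rw [abs_mul, habs, abs_of_nonneg (Real.rpow_nonneg hN0 _),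
        Real.mul_rpow (Real.rpow_nonneg hN0 _) (Real.rpow_nonneg (abs_nonneg _) _),
        ← Real.rpow_mul hN0, ← Real.rpow_mul (abs_nonneg _), hpq.symm.sub_one_mul_conj,
        neg_mul, inv_mul_cancel₀ hpq.pos.ne', Real.rpow_neg_one]
    rw [Finset.sum_congr rfl fun i _ => this i, ← Finset.mul_sum, ← hN, inv_mul_cancel₀ hpos.ne']
  have h1 := hy x hxL
  have h2 : inner ℝ y x = N ^ q⁻¹ := by
    have : inner ℝ y x = ∑ i, N ^ (-p⁻¹) * |y i| ^ q := by
      rw [PiLp.inner_apply]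
      refine Finset.sum_congr rfl fun i _ => ?_
      simp only [hx, RCLike.inner_apply, conj_trivial]
      rw [← hmul]; ring
    rw [this, ← Finset.mul_sum, ← hN, ← Real.rpow_add_one hpos.ne']
    congr 1
    linarith [hpq.inv_add_inv_eq_one]
  rw [h2] at h1
  by_contra h
  exact absurd h1 (not_le.2 (Real.one_lt_rpow (not_le.1 h) (inv_pos.2 hpq.symm.pos)))

/-- A scalar modulus for Young's inequality yields a modulus of convexity of the polar of the
`ℓ_p` ball at norming functionals. -/
theorem modulus_of_young_defect {Φ : ℝ → ℝ} {Ψ : ℝ → ℝ} (hpq : p.HolderConjugate q)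
    (hΦ : ∀ a y : ℝ, |a| ≤ 1 → |y| ≤ 1 →
      Φ |y - signedRpow a (p - 1)| ≤ |a| ^ p / p + |y| ^ q / q - a * y)
    (hΨ : ∀ d : EuclideanSpace ℝ (Fin n), Ψ ‖d‖ ≤ ∑ i, Φ |d i|)
    (hΨ0 : ∀ t, 0 ≤ t → Ψ t ≤ 0 → t = 0)
    {x Y y : EuclideanSpace ℝ (Fin n)} (hx : x ∈ lpUnitBall p n)
    (hY : Y ∈ innerPolar (lpUnitBall p n)) (hy : y ∈ innerPolar (lpUnitBall p n))
    (hYx : inner ℝ Y x = 1) : Ψ ‖y - Y‖ ≤ 1 - inner ℝ y x := by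
  have hp0 := hpq.pos
  have hq0 := hpq.symm.pos
  -- `Z` is the explicit candidate for the norming functional at `x`; the estimate applied to `Y`,
  -- whose defect is zero, forces `Y = Z`.
  set Z : EuclideanSpace ℝ (Fin n) := WithLp.toLp 2 fun i => signedRpow (x i) (p - 1) with hZ
  have main : ∀ y ∈ innerPolar (lpUnitBall p n), Ψ ‖y - Z‖ ≤ 1 - inner ℝ y x := by
    intro y hy
    calc Ψ ‖y - Z‖ ≤ ∑ i, Φ |(y - Z) i| := hΨ _
      _ ≤ ∑ i, (|x i| ^ p / p + |y i| ^ q / q - x i * y i) := by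
          refine Finset.sum_le_sum fun i _ => ?_
          exact hΦ (x i) (y i) (abs_apply_le_one_of_mem_lpUnitBall hp0 hx i)
            (abs_apply_le_one_of_mem_innerPolar hp0 hy i)
      _ = (∑ i, |x i| ^ p) / p + (∑ i, |y i| ^ q) / q - inner ℝ y x := by
          rw [Finset.sum_sub_distrib, Finset.sum_add_distrib, Finset.sum_div, Finset.sum_div,
            PiLp.inner_apply]
          congr 1
      _ ≤ 1 / p + 1 / q - inner ℝ y x := by
          have h1 := div_le_div_of_nonneg_right (show ∑ i, |x i| ^ p ≤ 1 from hx) hp0.le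
          have h2 := div_le_div_of_nonneg_right (sum_abs_rpow_le_one_of_mem_innerPolar hpq hy) hq0.le
          linarith
      _ = 1 - inner ℝ y x := by
          rw [one_div, one_div, hpq.inv_add_inv_eq_one]
  have h1 := main Y hY
  rw [hYx, sub_self] at h1
  have h2 : Y = Z := sub_eq_zero.1 (norm_eq_zero.1 (hΨ0 _ (norm_nonneg _) h1))
  rw [h2]
  exact main y hy

/-- Power type two modulus of the polar of the `ℓ_p` ball for `p ≥ 2`. -/
theorem lpUnitBall_modulus_of_two_le (hp : 2 ≤ p)
    {x Y y : EuclideanSpace ℝ (Fin n)} (hx : x ∈ lpUnitBall p n)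
    (hY : Y ∈ innerPolar (lpUnitBall p n)) (hy : y ∈ innerPolar (lpUnitBall p n))
    (hYx : inner ℝ Y x = 1) :
    1 / (2 * (p - 1)) * ‖y - Y‖ ^ (2 : ℝ) ≤ 1 - inner ℝ y x := by
  have hpq := Real.HolderConjugate.conjExponent (by linarith : 1 < p)
  set q := p.conjExponent with hq
  have hq1 : q - 1 = 1 / (p - 1) := by
    have : p - 1 ≠ 0 := by linarith
    rw [hq, Real.conjExponent]; field_simp; ring
  have hω : 1 / (2 * (p - 1)) = (q - 1) / 2 := by rw [hq1]; field_simp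
  have hp1 : 0 < p - 1 := by linarith
  have hq2 : q ≤ 2 := by
    have : 1 / (p - 1) ≤ 1 := by rw [div_le_one hp1]; linarith
    linarith
  have hq0 : 0 < (q - 1) / 2 := by linarith [hpq.symm.sub_one_pos]
  rw [hω]
  simp only [Real.rpow_two]
  refine modulus_of_young_defect (Φ := fun t => (q - 1) / 2 * t ^ 2)
    (Ψ := fun t => (q - 1) / 2 * t ^ 2) hpq ?_ ?_ ?_ hx hY hy hYx
  · intro a y ha hy
    refine young_defect_ge_of_nonneg (Φ := fun t => (q - 1) / 2 * t ^ 2) hpq ?_ ha hy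
    intro Y y hY0 hY1 hy
    rw [sq_abs]
    exact rpow_bregman_ge_sq hpq.symm.lt hq2 hY0 hY1 hy
  · intro d
    simp only [← Finset.mul_sum, EuclideanSpace.norm_sq_eq, Real.norm_eq_abs]
    exact le_rfl
  · intro t ht h
    have : t ^ 2 ≤ 0 := by
      by_contra hc
      exact absurd h (not_le.2 (mul_pos hq0 (not_le.1 hc)))
    exact pow_eq_zero_iff two_ne_zero |>.1 (le_antisymm this (sq_nonneg t))

/-- Power type `q` modulus of the polar of the `ℓ_p` ball for `p ≤ 2` and the conjugate
exponent `q`. -/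
theorem lpUnitBall_modulus_of_le_two (hn : 0 < n) (hpq : p.HolderConjugate q) (hq : 2 ≤ q)
    {x Y y : EuclideanSpace ℝ (Fin n)} (hx : x ∈ lpUnitBall p n)
    (hY : Y ∈ innerPolar (lpUnitBall p n)) (hy : y ∈ innerPolar (lpUnitBall p n))
    (hYx : inner ℝ Y x = 1) :
    2 / q * ((2 * √n) ^ q)⁻¹ * ‖y - Y‖ ^ q ≤ 1 - inner ℝ y x := by
  have hq0 : 0 < q := by linarith
  have hs : 0 < √(n : ℝ) := Real.sqrt_pos.2 (by exact_mod_cast hn)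
  have hω : 0 < 2 / q * ((2 * √(n : ℝ)) ^ q)⁻¹ := by positivity
  refine modulus_of_young_defect (Φ := fun t => 2 / q * (t / 2) ^ q)
    (Ψ := fun t => 2 / q * ((2 * √n) ^ q)⁻¹ * t ^ q) hpq ?_ ?_ ?_ hx hY hy hYx
  · intro a y ha hy
    exact young_defect_ge_of_nonneg (Φ := fun t => 2 / q * (t / 2) ^ q) hpq
      (fun Y y hY0 _ _ => rpow_bregman_ge_rpow hq hY0) ha hy
  · intro d
    simp only
    have : Nonempty (Fin n) := ⟨⟨0, hn⟩⟩
    -- Only the largest coordinate is kept, via `‖d‖ ≤ √n |d k|`; this is the source of `(2 √n) ^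
    -- q`.
    obtain ⟨k, -, hk⟩ := Finset.exists_max_image (Finset.univ : Finset (Fin n)) (fun i => |d i|)
      Finset.univ_nonempty
    have h1 : ‖d‖ ≤ √n * |d k| := by
      rw [EuclideanSpace.norm_eq, Real.sqrt_le_left (by positivity), mul_pow,
        Real.sq_sqrt (Nat.cast_nonneg n)]
      calc ∑ i, ‖d i‖ ^ 2 ≤ ∑ _i : Fin n, |d k| ^ 2 :=
            Finset.sum_le_sum fun i hi => pow_le_pow_left₀ (norm_nonneg _) (hk i hi) 2
        _ = n * |d k| ^ 2 := by simp
    have h2 : ((2 * √(n : ℝ)) ^ q)⁻¹ * ‖d‖ ^ q = (‖d‖ / (2 * √n)) ^ q := by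
      rw [Real.div_rpow (norm_nonneg _) (by positivity)]; field_simp
    rw [mul_assoc, h2, ← Finset.mul_sum]
    refine mul_le_mul_of_nonneg_left ?_ (by positivity)
    refine le_trans ?_ (Finset.single_le_sum (f := fun i => (|d i| / 2) ^ q)
      (fun i _ => Real.rpow_nonneg (by positivity) _) (Finset.mem_univ k))
    refine Real.rpow_le_rpow (by positivity) ?_ hq0.le
    rw [div_le_div_iff₀ (by positivity) two_pos]
    nlinarith
  · intro t ht h
    by_contra hne
    have : 0 < t := lt_of_le_of_ne ht (Ne.symm hne)
    exact absurd h (not_le.2 (by positivity))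

end LpBall

/-! ### The two ranges of `p` -/

section Main

variable {n : ℕ}

/-- With `s = 2` and `τ ^ 2 = 2 (p - 1) ε` the general bound is linear in `ε`, stronger in order
than the stated cube root. -/
theorem banachMazurDist_simplex_le_of_two_le (hn : 2 ≤ n) {K : Set (EuclideanSpace ℝ (Fin n))}
    (hK : IsConvexBody K) (S : Affine.Simplex ℝ (EuclideanSpace ℝ (Fin n)) n) {p ε : ℝ}
    (hε : 0 ≤ ε) (hp : 2 ≤ p) (hεp : ε ≤ ((2 : ℝ) ^ 18 * (p - 1) * (n : ℝ) ^ 14)⁻¹)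
    (hd : (1 - ε) * (n : ℝ) ≤ banachMazurDist K (lpUnitBall p n)) :
    banachMazurDist K (convexHull ℝ (Set.range S.points)) ≤
      1 + 320 * (p - 1) ^ (1 / 3 : ℝ) * (n : ℝ) ^ (14 / 3 : ℝ) * ε ^ (1 / 3 : ℝ) := by
  have hn2 : (2 : ℝ) ≤ n := by exact_mod_cast hn
  have hn1 : (1 : ℝ) ≤ n := by linarith
  have hn0 : (0 : ℝ) < n := by linarith
  have hp1 : 0 < p - 1 := by linarith
  have hp0 : 0 < p := by linarith
  set A := (p - 1) * ε with hA
  have hA0 : 0 ≤ A := mul_nonneg hp1.le hε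
  have hA1 : 2 ^ 18 * (n : ℝ) ^ 14 * A ≤ 1 := by
    have h1 : 0 < (2 : ℝ) ^ 18 * (p - 1) * (n : ℝ) ^ 14 := by positivity
    have h2 := mul_le_mul_of_nonneg_right hεp h1.le
    rw [inv_mul_cancel₀ h1.ne'] at h2
    linarith
  set τ := √(2 * A) with hτ
  have hτ2 : τ ^ 2 = 2 * A := Real.sq_sqrt (by linarith)
  have hεA : ε ≤ A := le_mul_of_one_le_left hε (by linarith)
  have h14 : (1 : ℝ) ≤ (n : ℝ) ^ 14 := one_le_pow₀ hn1
  have hε1 : 1 < (1 - ε) * n := by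
    have : 2 ^ 18 * A ≤ 1 := by nlinarith
    nlinarith
  have key := banachMazurDist_simplex_le_of_modulus (n := n) (by simp) hn
    (isConvexBody_lpUnitBall (by linarith : 1 ≤ p)) (zero_mem_interior_lpUnitBall hp0)
    (fun x hx => neg_mem_lpUnitBall hx)
    (fun x hx => norm_le_sqrt_of_forall_abs_le_one (abs_apply_le_one_of_mem_lpUnitBall hp0 hx))
    (fun y hy => norm_le_sqrt_of_forall_abs_le_one (abs_apply_le_one_of_mem_innerPolar hp0 hy))
    (ω := 1 / (2 * (p - 1))) (s := 2) (τ := τ) (ε := ε) (by positivity) le_rfl (Real.sqrt_nonneg _)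
    (by
      have h1 : (128 * (n : ℝ) ^ 5 * τ) ^ 2 ≤ 1 ^ 2 := by
        rw [mul_pow, hτ2]
        have h2 : (n : ℝ) ^ 10 ≤ (n : ℝ) ^ 14 := pow_le_pow_right₀ hn1 (by norm_num)
        have h3 := mul_le_mul_of_nonneg_right h2 hA0
        have h4 : (128 * (n : ℝ) ^ 5) ^ 2 = 2 ^ 14 * (n : ℝ) ^ 10 := by ring
        rw [h4]
        have h5 : 0 ≤ (n : ℝ) ^ 14 * A := by positivity
        nlinarith
      exact abs_le_of_sq_le_sq' h1 zero_le_one |>.2)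
    (by rw [Real.rpow_two, hτ2, hA]; field_simp) hε1
    (fun x hx Y hY y hy h => lpUnitBall_modulus_of_two_le hp hx hY hy h) S hK hd
  refine key.trans ?_
  rw [hτ2]
  -- Writing `A = a ^ 2 · a`, the smallness of `ε` gives `2 ^ 12 n ^ 6 a ^ 2 ≤ 1`, and `3072 ≤ 2 ^
  -- 12`.
  set a := A ^ (1 / 3 : ℝ) with ha
  have ha0 : 0 ≤ a := Real.rpow_nonneg hA0 _
  have ha3 : a ^ 3 = A := by
    rw [ha, ← Real.rpow_natCast, ← Real.rpow_mul hA0]; norm_num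
  have ha1 : 64 * (n : ℝ) ^ 4 * a ≤ 1 := by
    have h1 : (64 * (n : ℝ) ^ 4 * a) ^ 3 ≤ 1 ^ 3 := by
      have h2 : (64 * (n : ℝ) ^ 4 * a) ^ 3 = 2 ^ 18 * (n : ℝ) ^ 12 * a ^ 3 := by ring
      rw [h2, ha3, one_pow]
      refine le_trans ?_ hA1
      have h2 : (n : ℝ) ^ 12 ≤ (n : ℝ) ^ 14 := pow_le_pow_right₀ hn1 (by norm_num)
      gcongr
    exact le_of_pow_le_pow_left₀ three_ne_zero zero_le_one h1
  have hfin : (p - 1) ^ (1 / 3 : ℝ) * ε ^ (1 / 3 : ℝ) = a := by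
    rw [ha, hA, Real.mul_rpow hp1.le hε]
  have hn14 : 1 ≤ (n : ℝ) ^ (14 / 3 : ℝ) := Real.one_le_rpow hn1 (by norm_num)
  have h1 : 320 * (p - 1) ^ (1 / 3 : ℝ) * (n : ℝ) ^ (14 / 3 : ℝ) * ε ^ (1 / 3 : ℝ)
      = 320 * (n : ℝ) ^ (14 / 3 : ℝ) * a := by rw [← hfin]; ring
  rw [h1]
  have h2 : (64 * (n : ℝ) ^ 4 * a) ^ 2 ≤ 1 := pow_le_one₀ (by positivity) ha1
  have h3 : 2 ^ 12 * (n : ℝ) ^ 6 * a ^ 2 ≤ 1 := by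
    refine le_trans ?_ h2
    have h4 : (n : ℝ) ^ 6 ≤ (n : ℝ) ^ 8 := pow_le_pow_right₀ hn1 (by norm_num)
    have h5 : (64 * (n : ℝ) ^ 4 * a) ^ 2 = 2 ^ 12 * (n : ℝ) ^ 8 * a ^ 2 := by ring
    rw [h5]
    gcongr
  have h4 : 1536 * (n : ℝ) ^ 6 * (2 * A) = 3072 * ((n : ℝ) ^ 6 * a ^ 2) * a := by
    rw [← ha3]; ring
  rw [h4]
  have h5 : 3072 * ((n : ℝ) ^ 6 * a ^ 2) * a ≤ 1 * a :=
    mul_le_mul_of_nonneg_right (by linarith) ha0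
  have h6 : 1 * a ≤ 320 * (n : ℝ) ^ (14 / 3 : ℝ) * a :=
    mul_le_mul_of_nonneg_right (by linarith) ha0
  linarith

/-- With `D = (q ε / 2) ^ (1 / q)` and `τ = 2 √n D` the general bound adds `24 n D · (2 ^ 8 n ^ 6
D)` to 1. The smallness of `ε` makes the last factor at most 1, and `D ≤ D ^ (q / (q + 1)) ≤ (q ε) ^
(1 / (q + 1))`. -/
theorem banachMazurDist_simplex_le_of_le_two (hn : 2 ≤ n) {K : Set (EuclideanSpace ℝ (Fin n))}
    (hK : IsConvexBody K) (S : Affine.Simplex ℝ (EuclideanSpace ℝ (Fin n)) n) {p ε : ℝ}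
    (hε : 0 ≤ ε) (hp1 : 1 < p) (hp2 : p ≤ 2)
    (hεp : ε ≤ (p / (p - 1) * (2 : ℝ) ^ ((15 * p - 7) / (p - 1)) *
        (n : ℝ) ^ ((11 * p - 5) / (p - 1)))⁻¹)
    (hd : (1 - ε) * (n : ℝ) ≤ banachMazurDist K (lpUnitBall p n)) :
    banachMazurDist K (convexHull ℝ (Set.range S.points)) ≤
      1 + 160 * (n : ℝ) ^ (9 / 2 + 1 / (2 * (2 * p - 1)) : ℝ) *
          (p / (p - 1)) ^ (1 / 2 - 1 / (2 * (2 * p - 1)) : ℝ) *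
          ε ^ (1 / 2 - 1 / (2 * (2 * p - 1)) : ℝ) := by
  have hn2 : (2 : ℝ) ≤ n := by exact_mod_cast hn
  have hn1 : (1 : ℝ) ≤ n := by linarith
  have hn0 : (0 : ℝ) < n := by linarith
  have hp0 : 0 < p := by linarith
  have hp1' : 0 < p - 1 := by linarith
  have hpq : p.HolderConjugate (p / (p - 1)) := Real.HolderConjugate.conjExponent hp1
  -- All exponents except that of the final power of `n` are rewritten through the conjugate
  -- exponent `p / (p - 1)`, which is then generalized to `q`.
  have e1 : (15 * p - 7) / (p - 1) = 7 + 8 * (p / (p - 1)) := by field_simp; ring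
  have e2 : (11 * p - 5) / (p - 1) = 5 + 6 * (p / (p - 1)) := by field_simp; ring
  have e3 : (1 / 2 - 1 / (2 * (2 * p - 1)) : ℝ) = 1 / (p / (p - 1) + 1) := by
    have h1 : p - 1 + p ≠ 0 := by linarith
    have h2 : 2 * p - 1 ≠ 0 := by linarith
    have h3 : p / (p - 1) + 1 = (2 * p - 1) / (p - 1) := by field_simp; ring
    rw [h3]
    field_simp
    ring
  have hq2 : 2 ≤ p / (p - 1) := by rw [le_div_iff₀ hp1']; linarith
  have hexp : (1 : ℝ) ≤ 9 / 2 + 1 / (2 * (2 * p - 1)) := by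
    have : 0 ≤ 1 / (2 * (2 * p - 1)) := by
      apply div_nonneg <;> linarith
    linarith
  rw [e1, e2] at hεp
  rw [e3]
  generalize p / (p - 1) = q at hpq hq2 hεp ⊢
  have hq0 : 0 < q := by linarith
  set D := (q * ε / 2) ^ q⁻¹ with hD
  have hbase0 : 0 ≤ q * ε / 2 := by positivity
  have hD0 : 0 ≤ D := Real.rpow_nonneg hbase0 _
  have hDq : D ^ q = q * ε / 2 := by
    rw [hD, ← Real.rpow_mul hbase0, inv_mul_cancel₀ hq0.ne', Real.rpow_one]
  have hεq : q * ε * (((2 : ℝ) ^ 8) ^ q * ((n : ℝ) ^ 6) ^ q) ≤ 1 := by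
    have h1 : (0 : ℝ) < q * 2 ^ (7 + 8 * q) * (n : ℝ) ^ (5 + 6 * q) := by positivity
    have h2 : ε * (q * 2 ^ (7 + 8 * q) * (n : ℝ) ^ (5 + 6 * q)) ≤ 1 := by
      have := mul_le_mul_of_nonneg_right hεp h1.le
      rwa [inv_mul_cancel₀ h1.ne'] at this
    have h3 : ((2 : ℝ) ^ 8) ^ q ≤ 2 ^ (7 + 8 * q) := by
      rw [← Real.rpow_natCast, ← Real.rpow_mul (by norm_num)]
      exact Real.rpow_le_rpow_of_exponent_le (by norm_num) (by push_cast; linarith)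
    have h4 : ((n : ℝ) ^ 6) ^ q ≤ (n : ℝ) ^ (5 + 6 * q) := by
      rw [← Real.rpow_natCast, ← Real.rpow_mul hn0.le]
      exact Real.rpow_le_rpow_of_exponent_le hn1 (by push_cast; linarith)
    have h5 : q * ε * (((2 : ℝ) ^ 8) ^ q * ((n : ℝ) ^ 6) ^ q)
        ≤ q * ε * (2 ^ (7 + 8 * q) * (n : ℝ) ^ (5 + 6 * q)) := by gcongr
    linarith
  have hD1 : 2 ^ 8 * (n : ℝ) ^ 6 * D ≤ 1 := by
    have h1 : (2 ^ 8 * (n : ℝ) ^ 6 * D) ^ q ≤ 1 ^ q := by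
      rw [Real.mul_rpow (by positivity) hD0, Real.mul_rpow (by positivity) (by positivity), hDq,
        Real.one_rpow]
      calc ((2 : ℝ) ^ 8) ^ q * ((n : ℝ) ^ 6) ^ q * (q * ε / 2)
          = q * ε * (((2 : ℝ) ^ 8) ^ q * ((n : ℝ) ^ 6) ^ q) / 2 := by ring
        _ ≤ 1 / 2 := div_le_div_of_nonneg_right hεq two_pos.le
        _ ≤ 1 := by norm_num
    exact (Real.rpow_le_rpow_iff (by positivity) zero_le_one hq0).1 h1
  have hsn : √(n : ℝ) ≤ n := by rw [Real.sqrt_le_left hn0.le]; nlinarith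
  have hs0 : 0 < √(n : ℝ) := Real.sqrt_pos.2 hn0
  have hs2 : √(n : ℝ) ^ 2 = n := Real.sq_sqrt hn0.le
  have hε1 : 1 < (1 - ε) * n := by
    have h1 : (1 : ℝ) ≤ ((n : ℝ) ^ 6) ^ q := Real.one_le_rpow (one_le_pow₀ hn1) hq0.le
    have h2 : (2 : ℝ) ^ 8 ≤ ((2 : ℝ) ^ 8) ^ q := Real.self_le_rpow_of_one_le (by norm_num) (by linarith)
    have h3 : (2 : ℝ) ^ 8 * 1 ≤ ((2 : ℝ) ^ 8) ^ q * ((n : ℝ) ^ 6) ^ q := by gcongr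
    have h4 : 2 * ε ≤ q * ε := mul_le_mul_of_nonneg_right hq2 hε
    have h5 : 2 * ε * (2 ^ 8 * 1) ≤ q * ε * (((2 : ℝ) ^ 8) ^ q * ((n : ℝ) ^ 6) ^ q) := by gcongr
    nlinarith
  have key := banachMazurDist_simplex_le_of_modulus (n := n) (by simp) hn
    (isConvexBody_lpUnitBall hp1.le) (zero_mem_interior_lpUnitBall hp0)
    (fun x hx => neg_mem_lpUnitBall hx)
    (fun x hx => norm_le_sqrt_of_forall_abs_le_one (abs_apply_le_one_of_mem_lpUnitBall hp0 hx))
    (fun y hy => norm_le_sqrt_of_forall_abs_le_one (abs_apply_le_one_of_mem_innerPolar hp0 hy))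
    (ω := 2 / q * ((2 * √n) ^ q)⁻¹) (s := q) (τ := 2 * √n * D) (ε := ε) (by positivity) hq2
    (by positivity)
    (by
      have : 128 * (n : ℝ) ^ 5 * (2 * √(n : ℝ) * D) ≤ 128 * (n : ℝ) ^ 5 * (2 * n * D) := by gcongr
      refine this.trans (le_trans (le_of_eq ?_) hD1)
      ring)
    (by rw [Real.mul_rpow (by positivity) hD0, hDq]; field_simp) hε1
    (fun x hx Y hY y hy h => lpUnitBall_modulus_of_le_two (by omega) hpq hq2 hx hY hy h) S hK hd
  refine key.trans ?_
  have hDle : D ≤ 1 := by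
    have : (1 : ℝ) ≤ (n : ℝ) ^ 6 := one_le_pow₀ hn1
    nlinarith
  have hfin : D ≤ q ^ (1 / (q + 1)) * ε ^ (1 / (q + 1)) := by
    rw [← Real.mul_rpow hq0.le hε]
    calc D ≤ D ^ (q * (1 / (q + 1))) := by
          rcases hD0.eq_or_lt with h | h
          · rw [← h]; exact Real.rpow_nonneg le_rfl _
          · conv_lhs => rw [← Real.rpow_one D]
            refine Real.rpow_le_rpow_of_exponent_ge h hDle ?_
            rw [mul_one_div, div_le_one (by linarith)]; linarith
      _ = (q * ε / 2) ^ (1 / (q + 1)) := by rw [Real.rpow_mul hD0, hDq]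
      _ ≤ (q * ε) ^ (1 / (q + 1)) := by
          refine Real.rpow_le_rpow hbase0 ?_ (by positivity)
          have : 0 ≤ q * ε := by positivity
          linarith
  have hnn : (n : ℝ) ≤ (n : ℝ) ^ (9 / 2 + 1 / (2 * (2 * p - 1)) : ℝ) :=
    Real.self_le_rpow_of_one_le hn1 hexp
  have h1 : 1536 * (n : ℝ) ^ 6 * (2 * √(n : ℝ) * D) ^ 2 = 24 * n * D * (2 ^ 8 * (n : ℝ) ^ 6 * D) := by
    rw [mul_pow, mul_pow, hs2]; ring
  have h2 : 24 * n * D * (2 ^ 8 * (n : ℝ) ^ 6 * D) ≤ 24 * n * D * 1 :=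
    mul_le_mul_of_nonneg_left hD1 (by positivity)
  have h3 : (n : ℝ) * D ≤ (n : ℝ) ^ (9 / 2 + 1 / (2 * (2 * p - 1)) : ℝ)
      * (q ^ (1 / (q + 1)) * ε ^ (1 / (q + 1))) := by gcongr
  have h4 : 0 ≤ (n : ℝ) * D := by positivity
  rw [h1]
  nlinarith

end Main

theorem mainTheorem3 (n : ℕ) (hn : 2 ≤ n) (K : Set (EuclideanSpace ℝ (Fin n)))
    (hK : IsConvexBody K)
    (S : Affine.Simplex ℝ (EuclideanSpace ℝ (Fin n)) n) (hS : S.Equilateral)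
    (p ε : ℝ) (hε : 0 ≤ ε) :
    (2 ≤ p →
      ε ≤ ((2 : ℝ) ^ 18 * (p - 1) * (n : ℝ) ^ 14)⁻¹ →
      (1 - ε) * (n : ℝ) ≤ banachMazurDist K (lpUnitBall p n) →
      banachMazurDist K (convexHull ℝ (Set.range S.points)) ≤
        1 + 320 * (p - 1) ^ (1 / 3 : ℝ) * (n : ℝ) ^ (14 / 3 : ℝ) * ε ^ (1 / 3 : ℝ)) ∧
    (1 < p → p ≤ 2 →
      ε ≤ (p / (p - 1) * (2 : ℝ) ^ ((15 * p - 7) / (p - 1)) *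
        (n : ℝ) ^ ((11 * p - 5) / (p - 1)))⁻¹ →
      (1 - ε) * (n : ℝ) ≤ banachMazurDist K (lpUnitBall p n) →
      banachMazurDist K (convexHull ℝ (Set.range S.points)) ≤
        1 + 160 * (n : ℝ) ^ (9 / 2 + 1 / (2 * (2 * p - 1)) : ℝ) *
          (p / (p - 1)) ^ (1 / 2 - 1 / (2 * (2 * p - 1)) : ℝ) *
          ε ^ (1 / 2 - 1 / (2 * (2 * p - 1)) : ℝ)) :=
  ⟨fun hp hεp hd => banachMazurDist_simplex_le_of_two_le hn hK S hε hp hεp hd,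
    fun hp1 hp2 hεp hd => banachMazurDist_simplex_le_of_le_two hn hK S hε hp1 hp2 hεp hd⟩
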